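/- Let $d\ge 1$ and let $J:\mathbb Z^d\to[0,\infty)$ be symmetric ($J(x)=J(-x)$ for all $x$) and integrable ($\sum_{x}J(x)<\infty$). For $\beta\ge 0$ let $\mathbf P_\beta$ be the law of the random graph with vertex set $\mathbb Z^d$ in which each pair $\{x,y\}$ of distinct vertices is independently joined by an edge with probability $1-\exp(-\beta J(y-x))$. Its connected components are called clusters, $K_0$ is the cluster of the origin, and $\{0\leftrightarrow x\}$ is the event that $x\in K_0$. Let $\beta_c=\sup\{\beta\ge 0:\ \mathbf P_\beta\text{-almost surely there are no infinite clusters}\}\in[0,\infty]$, and let $\Lambda_r=[-r,r]^d\cap\mathbb Z^d$. Suppose that there exist $\alpha<d$, $c>0$ and $r_0<\infty$ such that $J(x)\ge c\|x\|_1^{-d-\alpha}$ for every $x\in\mathbb Z^d$ with $\|x\|_1\ge r_0$. Then there exists a constant $C$ such that $$\mathbf P_\beta(|K_0|\ge n)\le C\,n^{-(d-\alpha)/(2d+\alpha)}\qquad\text{and}\qquad \frac1{|\Lambda_r|}\sum_{x\in\Lambda_r}\mathbf P_\beta(0\leftrightarrow x)\le C\,r^{-2(d-\alpha)/3}$$ for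 every $0\le\beta\le\beta_c$, every integer $n\ge 1$ and every real $r\ge 1$. In particular, $\beta_c<\infty$ and there are $\mathbf P_{\beta_c}$-almost surely no infinite clusters. -/

import Mathlib

open MeasureTheory ProbabilityTheory
open scoped NNReal ENNReal

namespace LongRangePercolation

/-- The `ℓ¹` norm on `ℤ^d`. -/
def l1norm {d : ℕ} (x : Fin d → ℤ) : ℝ := ∑ i, |(x i : ℝ)|

/-- The box `Λ_r = [-r, r]^d ∩ ℤ^d` (for real `r ≥ 0`). -/
noncomputable def box (d : ℕ) (r : ℝ) : Finset (Fin d → ℤ) :=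
  Finset.Icc (fun _ => -⌊r⌋) (fun _ => ⌊r⌋)

theorem mem_box {d : ℕ} {r : ℝ} {x : Fin d → ℤ} :
    x ∈ box d r ↔ ∀ i, |(x i : ℝ)| ≤ r := by
  have key : ∀ n : ℤ, (-⌊r⌋ ≤ n ∧ n ≤ ⌊r⌋) ↔ |(n : ℝ)| ≤ r := by
    intro n
    rw [neg_le, Int.le_floor, Int.le_floor, abs_le, neg_le]
    push_cast
    rfl
  simp only [box, Finset.mem_Icc, Pi.le_def, ← forall_and, key]

/-- The intensity `J(y - x)` of the unordered pair `{x, y}`, for symmetric `J`. -/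
def pairIntensity {d : ℕ} (J : (Fin d → ℤ) → ℝ≥0) (hJ : ∀ x, J (-x) = J x) :
    Sym2 (Fin d → ℤ) → ℝ≥0 :=
  Sym2.lift ⟨fun x y => J (y - x), fun x y => by
    show J (y - x) = J (x - y)
    rw [← hJ (y - x), neg_sub]⟩

/-- The inclusion probability `1 - exp(-t)`, as an element of the unit interval. -/
noncomputable def openProb (t : ℝ≥0) : unitInterval :=
  ⟨1 - Real.exp (-(t : ℝ)), by
    constructor
    · have : Real.exp (-(t : ℝ)) ≤ 1 := Real.exp_le_one_iff.mpr (by simp)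
      linarith
    · have := Real.exp_pos (-(t : ℝ))
      linarith⟩

/-- The law `P_β` of the random configuration: each pair `{x, y}` is independently open (`true`)
with probability `1 - exp(-β J(y - x))`. The pairs `{x, x}` also receive a state, which
`openGraph` ignores. -/
noncomputable def perc {d : ℕ} (J : (Fin d → ℤ) → ℝ≥0) (hJ : ∀ x, J (-x) = J x) (β : ℝ≥0) :
    Measure (Sym2 (Fin d → ℤ) → Bool) :=
  Measure.infinitePi fun e => bernoulliMeasure true false (openProb (β * pairIntensity J hJ e))

instance {d : ℕ} (J : (Fin d → ℤ) → ℝ≥0) (hJ : ∀ x, J (-x) = J x) (β : ℝ≥0) :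
    IsProbabilityMeasure (perc J hJ β) := by
  unfold perc
  infer_instance

/-- The graph on `V` whose edges are the open pairs of distinct vertices. -/
def openGraph {V : Type*} (ω : Sym2 V → Bool) : SimpleGraph V :=
  SimpleGraph.fromEdgeSet {e | ω e = true}

/-- The cluster of `x`: the vertex set of its connected component in the open graph. -/
def cluster {V : Type*} (ω : Sym2 V → Bool) (x : V) : Set V :=
  {y | (openGraph ω).Reachable x y}

/-- The critical parameter: the supremum in `[0, ∞]` of the `β ≥ 0` for which there are
`P_β`-almost surely no infinite clusters. -/
noncomputable def betaC {d : ℕ} (J : (Fin d → ℤ) → ℝ≥0) (hJ : ∀ x, J (-x) = J x) : ℝ≥0∞ :=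
  sSup {b : ℝ≥0∞ | ∃ β : ℝ≥0, b = β ∧ ∀ᵐ ω ∂(perc J hJ β), ∀ x, (cluster ω x).Finite}

end LongRangePercolation

/-!
The proof works in finite volume: for a finite set `F` of pairs and edge probabilities `p`, `bernExp`
and `bernProb` are expectations and probabilities over the random set of open edges in `F`, and
every inductive argument conditions on one edge (`bernExp_insert`). Write `K` for a cluster,
`θ = (d - α) / (2 d + α)`, and `tail p k` for the probability that the cluster of the origin has at
least `k` vertices. Summability of `J` forces `α > 0` (`alpha_pos`), hence `0 < θ < 1 / 2`.

*Bootstrap.* Suppose `tail p k ≤ A k ^ (-θ)` for all `k`. A cluster with `3 l` points in a set `B`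
splits into two edge-disjoint connected pieces with `l` points of `B` each, so the van den Berg–Kesten
inequality gives `P(|K ∩ B| ≥ 3 l) ≤ P(|K ∩ B| ≥ l) |B| tail(l) / l`. Hence `E|K ∩ B|` is carried by
sizes up to `(A |B|) ^ (1 / (1 + θ))`, which bounds the averaged two-point function
(`bernExp_cardIn_le_of_tail`). On the other hand, when a cluster is explored edge by edge, the
weighted discrepancy between expected and actual numbers of open edges is a martingale, whose size is
controlled by the tail (`bernExp_abs_imbalance_div_le`). Summing it over all clusters with
a concave function of the cluster size gives the two-ghost inequality `sum_twoLarge_le`, which bounds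
the probability that an edge joins two distinct clusters of size at least `n`. Since by
Harris–FKG two points lie in clusters of size at least `n` with probability at least `tail(n) ^ 2`,
the two bounds combine to `tail_sq_le`, at distances of order `n ^ ((1 + θ) / d)`; there the best
constant `A` satisfies `A ^ 2 ≤ C A ^ (2 / (1 + θ))`, so it is bounded by a constant depending only on
the lower bound for the edge probabilities (`exists_uniform_tail_bound`).

*A priori bound.* The bootstrap needs some finite `A`. If there are no infinite clusters at `β'` and
`β < β'`, the cluster size at `β` has an exponential tail (`exists_tail_bound_of_lt`): weighting the
percolation of parameter `β'` by `s ^ |K|` with `s` close to `1` gives a law of the cluster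
which dominates that at parameter `β`, by an exploration in which only the Harris–FKG inequality is
used (`bernProb_mul_bernExp_pow_le`).

*Conclusion.* The bound is uniform for subcritical `β` away from `0`. It is incompatible with
`tail(n) → 1` as `β → ∞`, so `β_c < ∞`, and it passes to `β_c` by left-continuity of `tail`.
-/

namespace LongRangePercolation

/-! ### Expectations over finitely many independent edges -/

section FiniteVolume

variable {E : Type*} [DecidableEq E]

/-- The expectation of `f S`, where `S ⊆ F` is the random set of open edges and each `e ∈ F` is
open independently with probability `p e`. -/
def bernExp (p : E → ℝ) (F : Finset E) (f : Finset E → ℝ) : ℝ :=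
  ∑ S ∈ F.powerset, (∏ e ∈ S, p e) * (∏ e ∈ F \ S, (1 - p e)) * f S

open Classical in
/-- The probability that the random set `S ⊆ F` of open edges satisfies `Q`. -/
noncomputable def bernProb (p : E → ℝ) (F : Finset E) (Q : Finset E → Prop) : ℝ :=
  bernExp p F fun S => if Q S then 1 else 0

variable {p q : E → ℝ} {F F' : Finset E} {f g : Finset E → ℝ}

@[simp] theorem bernExp_empty : bernExp p ∅ f = f ∅ := by simp [bernExp]

/-- Conditioning on the state of one edge. All inductions over finite edge sets rest on it. -/
theorem bernExp_insert {e : E} (he : e ∉ F) :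
    bernExp p (insert e F) f =
      p e * bernExp p F (fun S => f (insert e S)) + (1 - p e) * bernExp p F f := by
  unfold bernExp
  rw [Finset.sum_powerset_insert he, add_comm, Finset.mul_sum, Finset.mul_sum]
  congr 1
  · refine Finset.sum_congr rfl fun S hS => ?_
    have hS' := Finset.mem_powerset.1 hS
    have heS : e ∉ S := fun h => he (hS' h)
    rw [Finset.prod_insert heS, Finset.insert_sdiff_insert, Finset.sdiff_insert_of_notMem he]
    ring
  · refine Finset.sum_congr rfl fun S hS => ?_
    have hS' := Finset.mem_powerset.1 hS
    have heS : e ∉ S := fun h => he (hS' h)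
    rw [Finset.insert_sdiff_of_notMem _ heS, Finset.prod_insert (by simp [he])]
    ring

theorem bernExp_congr (h : ∀ S ⊆ F, f S = g S) : bernExp p F f = bernExp p F g :=
  Finset.sum_congr rfl fun S hS => by rw [h S (Finset.mem_powerset.1 hS)]

theorem bernExp_le (hp : ∀ e, p e ∈ Set.Icc (0 : ℝ) 1) (h : ∀ S ⊆ F, f S ≤ g S) :
    bernExp p F f ≤ bernExp p F g :=
  Finset.sum_le_sum fun S hS => mul_le_mul_of_nonneg_left (h S (Finset.mem_powerset.1 hS))
    (mul_nonneg (Finset.prod_nonneg fun e _ => (hp e).1)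
      (Finset.prod_nonneg fun e _ => sub_nonneg.2 (hp e).2))

theorem bernExp_const (c : ℝ) : bernExp p F (fun _ => c) = c := by
  induction F using Finset.induction_on with
  | empty => simp
  | insert e F he ih => rw [bernExp_insert he, ih]; ring

theorem bernExp_eq_of_const {c : ℝ} (h : ∀ S ⊆ F, f S = c) : bernExp p F f = c :=
  (bernExp_congr h).trans (bernExp_const c)

theorem bernExp_add : bernExp p F (fun S => f S + g S) = bernExp p F f + bernExp p F g := by
  simp [bernExp, mul_add, Finset.sum_add_distrib]

theorem bernExp_sub : bernExp p F (fun S => f S - g S) = bernExp p F f - bernExp p F g := by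
  simp [bernExp, mul_sub, Finset.sum_sub_distrib]

theorem bernExp_const_mul (c : ℝ) : bernExp p F (fun S => c * f S) = c * bernExp p F f := by
  simp only [bernExp, Finset.mul_sum]
  exact Finset.sum_congr rfl fun _ _ => by ring

theorem bernExp_sum {ι : Type*} (s : Finset ι) (f : ι → Finset E → ℝ) :
    bernExp p F (fun S => ∑ i ∈ s, f i S) = ∑ i ∈ s, bernExp p F (f i) := by
  simp only [bernExp, Finset.mul_sum]
  exact Finset.sum_comm

theorem bernExp_nonneg (hp : ∀ e, p e ∈ Set.Icc (0 : ℝ) 1) (h : ∀ S ⊆ F, 0 ≤ f S) :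
    0 ≤ bernExp p F f := by
  rw [← bernExp_const (p := p) (F := F) 0]; exact bernExp_le hp h

theorem bernProb_le_of_imp (hp : ∀ e, p e ∈ Set.Icc (0 : ℝ) 1) {Q R : Finset E → Prop}
    (h : ∀ S ⊆ F, Q S → R S) : bernProb p F Q ≤ bernProb p F R := by
  refine bernExp_le hp fun S hS => ?_
  by_cases hQ : Q S
  · simp [hQ, h S hS hQ]
  · simp only [hQ, if_false]; split_ifs <;> norm_num

theorem bernProb_nonneg (hp : ∀ e, p e ∈ Set.Icc (0 : ℝ) 1) (Q : Finset E → Prop) :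
    0 ≤ bernProb p F Q := bernExp_nonneg hp fun S _ => by split_ifs <;> norm_num

theorem bernProb_le_one (hp : ∀ e, p e ∈ Set.Icc (0 : ℝ) 1) (Q : Finset E → Prop) :
    bernProb p F Q ≤ 1 := by
  rw [← bernExp_const (p := p) (F := F) 1]
  exact bernExp_le hp fun S _ => by split_ifs <;> norm_num

theorem bernProb_insert {e : E} (he : e ∉ F) (Q : Finset E → Prop) :
    bernProb p (insert e F) Q =
      p e * bernProb p F (fun S => Q (insert e S)) + (1 - p e) * bernProb p F Q :=
  bernExp_insert he

theorem bernProb_le_add (hp : ∀ e, p e ∈ Set.Icc (0 : ℝ) 1) {Q R₁ R₂ : Finset E → Prop}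
    (h : ∀ S ⊆ F, Q S → R₁ S ∨ R₂ S) : bernProb p F Q ≤ bernProb p F R₁ + bernProb p F R₂ := by
  classical
  unfold bernProb
  rw [← bernExp_add]
  refine bernExp_le hp fun S hS => ?_
  have := h S hS
  by_cases h1 : R₁ S <;> by_cases h2 : R₂ S <;> by_cases h3 : Q S <;> simp_all

/-- The layer-cake formula for a bounded integer-valued function. -/
theorem bernExp_sum_Icc_eq {X : Finset E → ℕ} {K : ℕ} (hX : ∀ S ⊆ F, X S ≤ K) (w : ℕ → ℝ) :
    bernExp p F (fun S => ∑ k ∈ Finset.Icc 1 (X S), w k) =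
      ∑ k ∈ Finset.Icc 1 K, w k * bernProb p F (fun S => k ≤ X S) := by
  classical
  simp only [bernProb, ← bernExp_const_mul]
  rw [← bernExp_sum]
  refine bernExp_congr fun S hS => ?_
  simp only [mul_ite, mul_one, mul_zero]
  rw [← Finset.sum_filter]
  refine Finset.sum_congr ?_ fun _ _ => rfl
  ext k
  have := hX S hS
  simp only [Finset.mem_Icc, Finset.mem_filter]
  omega

/-- The Harris–FKG inequality for increasing functions. -/
theorem bernExp_mul_le_bernExp_mul (hp : ∀ e, p e ∈ Set.Icc (0 : ℝ) 1) (hf : Monotone f)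
    (hg : Monotone g) : bernExp p F f * bernExp p F g ≤ bernExp p F (fun S => f S * g S) := by
  induction F using Finset.induction_on generalizing f g with
  | empty => simp
  | insert e F he ih =>
    have hins : Monotone (fun S : Finset E => insert e S) := fun _ _ h => Finset.insert_subset_insert _ h
    rw [bernExp_insert he, bernExp_insert he, bernExp_insert he]
    have h1 := ih (hf.comp hins) (hg.comp hins)
    have h0 := ih hf hg
    have hf' : bernExp p F f ≤ bernExp p F (f ∘ fun S => insert e S) :=
      bernExp_le hp fun S _ => hf (Finset.subset_insert _ _)
    have hg' : bernExp p F g ≤ bernExp p F (g ∘ fun S => insert e S) :=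
      bernExp_le hp fun S _ => hg (Finset.subset_insert _ _)
    simp only [Function.comp_def] at h1 hf' hg'
    have := mul_nonneg (mul_nonneg (hp e).1 (sub_nonneg.2 (hp e).2))
      (mul_nonneg (sub_nonneg.2 hf') (sub_nonneg.2 hg'))
    nlinarith [mul_le_mul_of_nonneg_left h1 (hp e).1,
      mul_le_mul_of_nonneg_left h0 (sub_nonneg.2 (hp e).2)]

theorem bernExp_mul_le_bernExp_mul_of_antitone (hp : ∀ e, p e ∈ Set.Icc (0 : ℝ) 1)
    (hf : Antitone f) (hg : Antitone g) :
    bernExp p F f * bernExp p F g ≤ bernExp p F (fun S => f S * g S) := by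
  have := bernExp_mul_le_bernExp_mul (F := F) hp (f := fun S => (-1) * f S)
    (g := fun S => (-1) * g S)
    (fun _ _ h => by simpa using hf h) (fun _ _ h => by simpa using hg h)
  rw [bernExp_const_mul, bernExp_const_mul] at this
  simpa using this

/-- `Q` is an increasing event. -/
def Increasing (Q : Finset E → Prop) : Prop := ∀ ⦃S T : Finset E⦄, S ⊆ T → Q S → Q T

open Classical in
theorem Increasing.monotone_ite {E : Type*} {Q : Finset E → Prop} (hQ : Increasing Q) :
    Monotone (fun S => if Q S then (1 : ℝ) else 0) := by
  intro S T h
  by_cases hS : Q S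
  · simp [hS, hQ h hS]
  · simp only [hS, if_false]; split_ifs <;> norm_num

theorem bernProb_mul_le_bernProb_and (hp : ∀ e, p e ∈ Set.Icc (0 : ℝ) 1) {Q R : Finset E → Prop}
    (hQ : Increasing Q) (hR : Increasing R) :
    bernProb p F Q * bernProb p F R ≤ bernProb p F (fun S => Q S ∧ R S) := by
  classical
  refine (bernExp_mul_le_bernExp_mul hp hQ.monotone_ite hR.monotone_ite).trans_eq ?_
  refine bernExp_congr fun S _ => ?_
  by_cases h1 : Q S <;> by_cases h2 : R S <;> simp [h1, h2]

/-- Increasing events are more likely in larger edge sets. -/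
theorem bernProb_mono_set (hp : ∀ e, p e ∈ Set.Icc (0 : ℝ) 1) {Q : Finset E → Prop}
    (hQ : Increasing Q) (h : F ⊆ F') : bernProb p F Q ≤ bernProb p F' Q := by
  induction F' using Finset.induction_on generalizing F Q with
  | empty => rw [Finset.subset_empty.1 h]
  | insert e F' he ih =>
    have h1 : ∀ {F}, bernProb p F Q ≤ bernProb p F (fun S => Q (insert e S)) :=
      fun {F} => bernProb_le_of_imp hp fun S _ => hQ (Finset.subset_insert _ _)
    have hQ' : Increasing (fun S => Q (insert e S)) :=
      fun _ _ h => hQ (Finset.insert_subset_insert _ h)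
    have h2 : bernProb p (F.erase e) Q ≤ bernProb p F' Q :=
      ih hQ (by rwa [Finset.subset_insert_iff] at h)
    have h3 : bernProb p (F.erase e) (fun S => Q (insert e S)) ≤
        bernProb p F' (fun S => Q (insert e S)) := ih hQ' (by rwa [Finset.subset_insert_iff] at h)
    rw [bernProb_insert he]
    by_cases heF : e ∈ F
    · rw [← Finset.insert_erase heF, bernProb_insert (Finset.notMem_erase _ _)]
      exact add_le_add (mul_le_mul_of_nonneg_left h3 (hp e).1)
        (mul_le_mul_of_nonneg_left h2 (sub_nonneg.2 (hp e).2))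
    · rw [Finset.erase_eq_of_notMem heF] at h2
      nlinarith [h1 (F := F'), (hp e).1, (hp e).2]

/-- Increasing events are more likely for larger edge probabilities. -/
theorem bernProb_mono_prob (hp : ∀ e, p e ∈ Set.Icc (0 : ℝ) 1) (hq : ∀ e, q e ∈ Set.Icc (0 : ℝ) 1)
    (hqp : ∀ e, q e ≤ p e) {Q : Finset E → Prop} (hQ : Increasing Q) :
    bernProb q F Q ≤ bernProb p F Q := by
  induction F using Finset.induction_on generalizing Q with
  | empty => simp [bernProb]
  | insert e F he ih =>
    have hQ' : Increasing (fun S => Q (insert e S)) :=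
      fun _ _ h => hQ (Finset.insert_subset_insert _ h)
    have h1 : bernProb p F Q ≤ bernProb p F (fun S => Q (insert e S)) :=
      bernProb_le_of_imp hp fun S _ => hQ (Finset.subset_insert _ _)
    rw [bernProb_insert he, bernProb_insert he]
    nlinarith [mul_le_mul_of_nonneg_left (ih hQ') (hq e).1,
      mul_le_mul_of_nonneg_left (ih hQ) (sub_nonneg.2 (hq e).2),
      mul_nonneg (sub_nonneg.2 (hqp e)) (sub_nonneg.2 h1)]

/-- `A` and `B` occur disjointly in `S`: they have disjoint witnesses inside `S`. -/
def DisjOcc (A B : Finset E → Prop) (S : Finset E) : Prop :=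
  ∃ S₁ S₂, S₁ ⊆ S ∧ S₂ ⊆ S ∧ Disjoint S₁ S₂ ∧ A S₁ ∧ B S₂

/-- The van den Berg–Kesten inequality for increasing events.

With `xᵢⱼ` the probability that `Aᵢ` and `Bⱼ` occur disjointly (`i`, `j` being the state of a
distinguished edge `e`), the disjoint occurrence with `e` open is the union of the events of
probabilities `x₁₀` and `x₀₁`, whose intersection contains that of probability `x₀₀` and
which is contained in that of probability `x₁₁`. Weighing the two resulting upper bounds by `1 - p`
and `p` gives `(1-p)² x₀₀ + p (1-p) (x₁₀ + x₀₁) + p² x₁₁`. -/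
theorem bernProb_disjOcc_le (hp : ∀ e, p e ∈ Set.Icc (0 : ℝ) 1) {A B : Finset E → Prop}
    (hA : Increasing A) (hB : Increasing B) :
    bernProb p F (DisjOcc A B) ≤ bernProb p F A * bernProb p F B := by
  classical
  induction F using Finset.induction_on generalizing A B with
  | empty =>
    by_cases h1 : A ∅ <;> by_cases h2 : B ∅ <;> simp [bernProb, DisjOcc, h1, h2]
  | insert e F he ih =>
    set A1 : Finset E → Prop := fun S => A (insert e S) with hA1
    set B1 : Finset E → Prop := fun S => B (insert e S) with hB1
    have iA1 : Increasing A1 := fun _ _ h => hA (Finset.insert_subset_insert _ h)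
    have iB1 : Increasing B1 := fun _ _ h => hB (Finset.insert_subset_insert _ h)
    have hAA1 : ∀ S, A S → A1 S := fun S => hA (Finset.subset_insert _ _)
    have hBB1 : ∀ S, B S → B1 S := fun S => hB (Finset.subset_insert _ _)
    have key : ∀ S ⊆ F, DisjOcc A B (insert e S) → DisjOcc A1 B S ∨ DisjOcc A B1 S := by
      rintro S - ⟨S₁, S₂, h1, h2, hd, ha, hb⟩
      rw [Finset.subset_insert_iff] at h1 h2
      by_cases h : e ∈ S₁
      · refine Or.inl ⟨S₁.erase e, S₂, h1, ?_, hd.mono_left (Finset.erase_subset _ _), ?_, hb⟩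
        · rwa [Finset.erase_eq_of_notMem (Finset.disjoint_left.1 hd h)] at h2
        · simpa [hA1, Finset.insert_erase h] using ha
      · refine Or.inr ⟨S₁, S₂.erase e, ?_, h2, hd.mono_right (Finset.erase_subset _ _), ha, ?_⟩
        · rwa [Finset.erase_eq_of_notMem h] at h1
        · exact hB (Finset.subset_insert_iff.2 (Finset.Subset.refl _)) hb
    have mono : ∀ {A A' B B' : Finset E → Prop}, (∀ S, A S → A' S) → (∀ S, B S → B' S) →
        ∀ S, DisjOcc A B S → DisjOcc A' B' S := fun h h' S ⟨S₁, S₂, h1, h2, hd, ha, hb⟩ =>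
      ⟨S₁, S₂, h1, h2, hd, h _ ha, h' _ hb⟩
    set u := bernProb p F (fun S => DisjOcc A B (insert e S)) with hu
    have hu11 : u ≤ bernProb p F (DisjOcc A1 B1) := bernProb_le_of_imp hp fun S hS h =>
      (key S hS h).elim (mono (fun _ => id) hBB1 S) (mono hAA1 (fun _ => id) S)
    have hu01 : u + bernProb p F (DisjOcc A B) ≤
        bernProb p F (DisjOcc A1 B) + bernProb p F (DisjOcc A B1) := by
      simp only [hu, bernProb]
      rw [← bernExp_add, ← bernExp_add]
      refine bernExp_le hp fun S hS => ?_
      have k1 := key S hS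
      have k2 := mono hAA1 (fun _ => id) S (A := A) (B := B)
      have k3 := mono (fun _ => id) hBB1 S (A := A) (B := B)
      clear key mono ih hu11
      by_cases c1 : DisjOcc A1 B S <;> by_cases c2 : DisjOcc A B1 S <;>
        by_cases c3 : DisjOcc A B S <;> by_cases c4 : DisjOcc A B (insert e S) <;>
        simp_all
    have b00 := ih hA hB
    have b10 := ih iA1 hB
    have b01 := ih hA iB1
    have b11 := ih iA1 iB1
    rw [bernProb_insert he, bernProb_insert he, bernProb_insert he]
    obtain ⟨h0, h1⟩ := hp e
    have h1' := sub_nonneg.2 h1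
    have t1 : p e * u ≤ p e * (1 - p e) * (bernProb p F A1 * bernProb p F B +
        bernProb p F A * bernProb p F B1 - bernProb p F (DisjOcc A B)) +
        p e * p e * (bernProb p F A1 * bernProb p F B1) := by
      have e1 := mul_le_mul_of_nonneg_left (show u ≤ bernProb p F A1 * bernProb p F B +
        bernProb p F A * bernProb p F B1 - bernProb p F (DisjOcc A B) by linarith)
        (mul_nonneg h0 h1')
      have e2 := mul_le_mul_of_nonneg_left (hu11.trans b11) (mul_nonneg h0 h0)
      linarith
    have t2 := mul_le_mul_of_nonneg_left b00 (mul_nonneg h1' h1')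
    linarith

/-- The law of the open edges is transported by an injective relabelling. -/
theorem bernExp_map {E' : Type*} [DecidableEq E'] (σ : E ↪ E') (p : E' → ℝ)
    (f : Finset E' → ℝ) :
    bernExp p (F.map σ) f = bernExp (p ∘ σ) F (fun S => f (S.map σ)) := by
  induction F using Finset.induction_on generalizing f with
  | empty => simp
  | insert e F he ih =>
    rw [Finset.map_insert, bernExp_insert (by simpa using he), bernExp_insert he, ih, ih]
    simp [Finset.map_insert]

theorem continuous_bernExp {X : Type*} [TopologicalSpace X] {p : X → E → ℝ}
    (hp : ∀ e, Continuous fun x => p x e) : Continuous fun x => bernExp (p x) F f := by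
  unfold bernExp
  fun_prop

/-- An event that holds when all edges are open has at least the probability of that
configuration. -/
theorem prod_le_bernProb (hp : ∀ e, p e ∈ Set.Icc (0 : ℝ) 1) {Q : Finset E → Prop} (hQ : Q F) :
    ∏ e ∈ F, p e ≤ bernProb p F Q := by
  classical
  unfold bernProb bernExp
  refine le_trans ?_ (Finset.single_le_sum (fun S _ => mul_nonneg
    (mul_nonneg (Finset.prod_nonneg fun e _ => (hp e).1)
      (Finset.prod_nonneg fun e _ => sub_nonneg.2 (hp e).2))
    (by split_ifs <;> norm_num)) (Finset.mem_powerset_self F))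
  simp [hQ]

end FiniteVolume

/-! ### Clusters of finite edge sets -/

section Clusters

variable {V : Type*}

/-- `x` and `y` are joined by a path of edges of `S`. -/
def Conn (S : Finset (Sym2 V)) (x y : V) : Prop :=
  (SimpleGraph.fromEdgeSet (S : Set (Sym2 V))).Reachable x y

variable {S T : Finset (Sym2 V)} {x y z : V}

namespace Conn

theorem refl (S : Finset (Sym2 V)) (x : V) : Conn S x x := SimpleGraph.Reachable.refl _

theorem symm (h : Conn S x y) : Conn S y x := SimpleGraph.Reachable.symm h

theorem trans (h : Conn S x y) (h' : Conn S y z) : Conn S x z := SimpleGraph.Reachable.trans h h'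

theorem mono (hST : S ⊆ T) (h : Conn S x y) : Conn T x y :=
  SimpleGraph.Reachable.mono (SimpleGraph.fromEdgeSet_mono (by exact_mod_cast hST)) h

theorem of_mem (h : s(x, y) ∈ S) : Conn S x y := by
  by_cases hxy : x = y
  · exact hxy ▸ refl S x
  · exact SimpleGraph.Adj.reachable ((SimpleGraph.fromEdgeSet_adj _).2 ⟨by exact_mod_cast h, hxy⟩)

/-- Induction along a path. -/
theorem induct {P : V → Prop} (h : Conn S x y) (hx : P x)
    (step : ∀ v w, Conn S x v → P v → s(v, w) ∈ S → P w) : P y := by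
  have h' := (SimpleGraph.reachable_iff_reflTransGen _ _).1 h
  induction h' with
  | refl => exact hx
  | tail h1 h2 ih =>
    have h3 := (SimpleGraph.reachable_iff_reflTransGen _ _).2 h1
    exact step _ _ h3 (ih h3) (by exact_mod_cast ((SimpleGraph.fromEdgeSet_adj _).1 h2).1)

end Conn

variable [DecidableEq V]

/-- The edge `e` has an endpoint in `A`. -/
def Touches (e : Sym2 V) (A : Finset V) : Prop := ∃ v ∈ A, v ∈ e

instance (e : Sym2 V) (A : Finset V) : Decidable (Touches e A) :=
  inferInstanceAs (Decidable (∃ v ∈ A, v ∈ e))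

open Classical in
/-- The set of vertices joined to `A` by a path of edges of `S`. It is cut out of the
finite set of vertices lying in `A` or on an edge of `S`. -/
noncomputable def clus (S : Finset (Sym2 V)) (A : Finset V) : Finset V :=
  {y ∈ A ∪ S.biUnion Sym2.toFinset | ∃ a ∈ A, Conn S a y}

variable {A B : Finset V} {a b u v : V}

theorem Conn.mem_or_mem_biUnion (h : Conn S x y) : y = x ∨ y ∈ S.biUnion Sym2.toFinset := by
  refine h.induct (P := fun y => y = x ∨ y ∈ S.biUnion Sym2.toFinset) (Or.inl rfl) ?_
  intro v w _ _ hvw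
  exact Or.inr (Finset.mem_biUnion.2 ⟨_, hvw, by simp⟩)

theorem mem_clus : y ∈ clus S A ↔ ∃ a ∈ A, Conn S a y := by
  classical
  simp only [clus, Finset.mem_filter, Finset.mem_union, and_iff_right_iff_imp]
  rintro ⟨a, ha, h⟩
  rcases h.mem_or_mem_biUnion with rfl | h
  · exact Or.inl ha
  · exact Or.inr h

@[simp] theorem mem_clus_singleton : y ∈ clus S {x} ↔ Conn S x y := by simp [mem_clus]

theorem subset_clus (S : Finset (Sym2 V)) (A : Finset V) : A ⊆ clus S A :=
  fun a ha => mem_clus.2 ⟨a, ha, Conn.refl S a⟩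

theorem card_clus_pos (S : Finset (Sym2 V)) (x : V) : 0 < (clus S {x}).card :=
  Finset.card_pos.2 ⟨x, subset_clus _ _ (Finset.mem_singleton_self x)⟩

theorem clus_mono (h : S ⊆ T) (A : Finset V) : clus S A ⊆ clus T A := fun y hy => by
  obtain ⟨a, ha, hc⟩ := mem_clus.1 hy
  exact mem_clus.2 ⟨a, ha, hc.mono h⟩

theorem mem_clus_of_mem_edge (h : v ∈ clus S A) (he : s(v, x) ∈ S) : x ∈ clus S A := by
  obtain ⟨a, ha, hc⟩ := mem_clus.1 h
  exact mem_clus.2 ⟨a, ha, hc.trans (Conn.of_mem he)⟩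

theorem mem_clus_of_touches {e : Sym2 V} (he : e ∈ S) (h : Touches e (clus S A)) (hx : x ∈ e) :
    x ∈ clus S A := by
  obtain ⟨v, hv, hve⟩ := h
  obtain ⟨w, rfl⟩ := Sym2.mem_iff_exists.1 hve
  rcases Sym2.mem_iff.1 hx with rfl | rfl
  · exact hv
  · exact mem_clus_of_mem_edge hv he

theorem clus_union : clus S (A ∪ B) = clus S A ∪ clus S B := by
  ext y
  simp only [mem_clus, Finset.mem_union]
  constructor
  · rintro ⟨a, ha | ha, h⟩
    exacts [Or.inl ⟨a, ha, h⟩, Or.inr ⟨a, ha, h⟩]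
  · rintro (⟨a, ha, h⟩ | ⟨a, ha, h⟩)
    exacts [⟨a, Or.inl ha, h⟩, ⟨a, Or.inr ha, h⟩]

theorem clus_insert_vertex : clus S (insert b A) = clus S {b} ∪ clus S A := by
  rw [Finset.insert_eq, clus_union]

/-- A set which no edge of `S` leaves is a union of clusters. -/
theorem clus_subset_of_closed (hAB : A ⊆ B) (h : ∀ v w, v ∈ B → s(v, w) ∈ S → w ∈ B) :
    clus S A ⊆ B := fun y hy => by
  obtain ⟨a, ha, hc⟩ := mem_clus.1 hy
  exact hc.induct (P := fun y => y ∈ B) (hAB ha) fun v w _ hv => h v w hv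

theorem clus_eq_self (h : ∀ e ∈ S, ¬ Touches e A) : clus S A = A :=
  (clus_subset_of_closed subset_rfl fun v w hv hvw =>
    (h _ hvw ⟨v, hv, Sym2.mem_mk_left v w⟩).elim).antisymm (subset_clus S A)

/-- Opening an edge that touches `A` adds its other endpoint to `A`. -/
theorem clus_insert_edge (ha : a ∈ A) : clus (insert s(a, b) S) A = clus S (insert b A) := by
  apply Finset.Subset.antisymm
  · refine clus_subset_of_closed ((Finset.subset_insert _ _).trans (subset_clus _ _)) ?_
    intro v w hv hvw
    rcases Finset.mem_insert.1 hvw with h | h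
    · rcases Sym2.eq_iff.1 h with ⟨-, rfl⟩ | ⟨-, rfl⟩
      · exact subset_clus _ _ (Finset.mem_insert_self _ _)
      · exact subset_clus _ _ (Finset.mem_insert_of_mem ha)
    · exact mem_clus_of_mem_edge hv h
  · intro y hy
    obtain ⟨c, hc, h⟩ := mem_clus.1 hy
    have h' := h.mono (Finset.subset_insert s(a, b) S)
    rcases Finset.mem_insert.1 hc with rfl | hc
    · exact mem_clus.2 ⟨a, ha, (Conn.of_mem (Finset.mem_insert_self _ _)).trans h'⟩
    · exact mem_clus.2 ⟨c, hc, h'⟩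

theorem clus_insert_edge_singleton :
    clus (insert s(a, b) S) {a} = clus S {a} ∪ clus S {b} := by
  rw [clus_insert_edge (Finset.mem_singleton_self a), clus_insert_vertex, Finset.union_comm]

theorem clus_eq_of_conn (h : Conn S x y) : clus S {x} = clus S {y} := by
  ext z
  simp only [mem_clus_singleton]
  exact ⟨h.symm.trans, h.trans⟩

theorem disjoint_clus (h : ¬ Conn S x y) : Disjoint (clus S {x}) (clus S {y}) :=
  Finset.disjoint_left.2 fun _ hx hy =>
    h ((mem_clus_singleton.1 hx).trans (mem_clus_singleton.1 hy).symm)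

theorem increasing_le_card_clus (A : Finset V) (n : ℕ) :
    Increasing fun S : Finset (Sym2 V) => n ≤ (clus S A).card :=
  fun _ _ h hn => hn.trans (Finset.card_le_card (clus_mono h A))

/-- The number of points of `B` in the cluster of `u`. -/
noncomputable def cardIn (S : Finset (Sym2 V)) (B : Finset V) (u : V) : ℕ :=
  (clus S {u} ∩ B).card

theorem cardIn_mono (h : S ⊆ T) (B : Finset V) (u : V) : cardIn S B u ≤ cardIn T B u :=
  Finset.card_le_card (Finset.inter_subset_inter_right (clus_mono h _))

theorem cardIn_le_card_clus : cardIn S B u ≤ (clus S {u}).card :=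
  Finset.card_le_card Finset.inter_subset_left

theorem cardIn_le_card : cardIn S B u ≤ B.card :=
  Finset.card_le_card Finset.inter_subset_right

theorem clus_filter_touches :
    clus (S.filter fun e => Touches e (clus S A)) A = clus S A := by
  refine (clus_mono (Finset.filter_subset _ _) A).antisymm ?_
  intro y hy
  obtain ⟨a, ha, hc⟩ := mem_clus.1 hy
  refine hc.induct (P := fun y => y ∈ clus (S.filter fun e => Touches e (clus S A)) A)
    (subset_clus _ _ ha) fun v w hv hv' hvw => mem_clus_of_mem_edge hv' ?_
  exact Finset.mem_filter.2 ⟨hvw, v, mem_clus.2 ⟨a, ha, hv⟩, Sym2.mem_mk_left v w⟩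

/-- A cluster with many points of `B` contains an edge-disjoint pair formed by a connected set with
at least `l` points of `B` and a connected set containing `u` which misses at
most `2 l` points of `B`. The induction removes an edge at `u`: if this disconnects the cluster, one
of the two parts still has at least `l` points of `B` and can be cut further. -/
theorem exists_disjoint_split {l : ℕ} (hl : 1 ≤ l) (B : Finset V) (S : Finset (Sym2 V)) (u : V)
    (h : l ≤ cardIn S B u) :
    ∃ S₁ S₂, S₁ ⊆ S ∧ S₂ ⊆ S ∧ Disjoint S₁ S₂ ∧ (∃ v, l ≤ cardIn S₂ B v) ∧
      cardIn S B u ≤ cardIn S₁ B u + 2 * l := by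
  induction S using Finset.strongInduction generalizing u with
  | H S ih =>
    by_cases h2 : cardIn S B u ≤ 2 * l
    · exact ⟨∅, S, by simp, subset_rfl, by simp, ⟨u, h⟩, by omega⟩
    have hex : ∃ e ∈ S, Touches e {u} := by
      by_contra! hne
      have h3 : (clus S {u}).card = 1 := by rw [clus_eq_self hne]; simp
      have := cardIn_le_card_clus (S := S) (B := B) (u := u)
      omega
    obtain ⟨e, heS, w, hw, hwe⟩ := hex
    obtain rfl := Finset.mem_singleton.1 hw
    obtain ⟨x, rfl⟩ := Sym2.mem_iff_exists.1 hwe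
    set S' := S.erase s(w, x) with hS'
    have hins : insert s(w, x) S' = S := Finset.insert_erase heS
    have hsub : S' ⊂ S := Finset.erase_ssubset heS
    have hclus : clus S {w} = clus S' {w} ∪ clus S' {x} := by
      rw [← hins, clus_insert_edge_singleton]
    by_cases hc : Conn S' w x
    · rw [clus_eq_of_conn hc, Finset.union_self, ← clus_eq_of_conn hc] at hclus
      have hW : cardIn S B w = cardIn S' B w := by simp only [cardIn, hclus]
      obtain ⟨S₁, S₂, h1, h2, hd, hv, hle⟩ := ih S' hsub w (by omega)
      exact ⟨S₁, S₂, h1.trans hsub.subset, h2.trans hsub.subset, hd, hv, by omega⟩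
    · have hdis := disjoint_clus hc
      have hW : cardIn S B w = cardIn S' B w + cardIn S' B x := by
        simp only [cardIn, hclus, Finset.union_inter_distrib_right]
        exact Finset.card_union_of_disjoint
          (hdis.mono Finset.inter_subset_left Finset.inter_subset_left)
      set P := fun y => S'.filter fun e => Touches e (clus S' {y}) with hP
      have hPS : ∀ y, P y ⊆ S' := fun y => Finset.filter_subset _ _
      have hPd : Disjoint (P w) (P x) := by
        refine Finset.disjoint_left.2 fun e h1 h2 => ?_
        obtain ⟨h1, v, hv, hve⟩ := Finset.mem_filter.1 h1
        have := mem_clus_of_touches h1 (Finset.mem_filter.1 h2).2 hve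
        exact Finset.disjoint_left.1 hdis hv this
      have hPW : ∀ y, cardIn (P y) B y = cardIn S' B y := fun y => by
        simp only [cardIn, hP, clus_filter_touches]
      have hne : ∀ {y}, s(w, x) ∉ P y := fun h => Finset.notMem_erase _ _ (hPS _ h)
      have glue : ∀ R₁ R₂, R₁ ⊆ P w → R₂ ⊆ P x →
          cardIn R₁ B w + cardIn R₂ B x ≤ cardIn (insert s(w, x) (R₁ ∪ R₂)) B w := by
        intro R₁ R₂ h1 h2
        simp only [cardIn, clus_insert_edge_singleton]
        rw [← Finset.card_union_of_disjoint]
        · rw [← Finset.union_inter_distrib_right]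
          exact Finset.card_le_card (Finset.inter_subset_inter_right (Finset.union_subset_union
            (clus_mono Finset.subset_union_left _) (clus_mono Finset.subset_union_right _)))
        · exact hdis.mono (Finset.inter_subset_left.trans (clus_mono (h1.trans (hPS _)) _))
            (Finset.inter_subset_left.trans (clus_mono (h2.trans (hPS _)) _))
      have hgS : ∀ {R₁ R₂}, R₁ ⊆ P w → R₂ ⊆ P x → insert s(w, x) (R₁ ∪ R₂) ⊆ S := by
        intro R₁ R₂ h1 h2
        exact Finset.insert_subset heS ((Finset.union_subset (h1.trans (hPS _))
          (h2.trans (hPS _))).trans hsub.subset)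
      rcases le_or_gt l (cardIn S' B x) with hx | hx
      · obtain ⟨S₁, S₂, h1, h2, hd, hv, hle⟩ :=
          ih (P x) ((hPS x).trans_ssubset hsub) x (by rw [hPW]; exact hx)
        refine ⟨insert s(w, x) (P w ∪ S₁), S₂, hgS subset_rfl h1,
          h2.trans ((hPS x).trans hsub.subset), ?_, hv, ?_⟩
        · rw [Finset.disjoint_insert_left, Finset.disjoint_union_left]
          exact ⟨fun h => hne (h2 h), hPd.mono_right h2, hd⟩
        · have := glue (P w) S₁ subset_rfl h1
          rw [hPW] at this hle
          omega
      · obtain ⟨S₁, S₂, h1, h2, hd, hv, hle⟩ :=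
          ih (P w) ((hPS w).trans_ssubset hsub) w (by rw [hPW]; omega)
        refine ⟨insert s(w, x) (S₁ ∪ P x), S₂, hgS h1 subset_rfl,
          h2.trans ((hPS w).trans hsub.subset), ?_, hv, ?_⟩
        · rw [Finset.disjoint_insert_left, Finset.disjoint_union_left]
          exact ⟨fun h => hne (h2 h), hd, hPd.symm.mono_right h2⟩
        · have := glue S₁ (P x) h1 subset_rfl
          rw [hPW] at this hle
          omega

theorem disjOcc_of_three_mul_le {l : ℕ} (hl : 1 ≤ l) (h : 3 * l ≤ cardIn S B u) :
    DisjOcc (fun S => l ≤ cardIn S B u) (fun S => ∃ v ∈ B, l ≤ cardIn S B v) S := by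
  obtain ⟨S₁, S₂, h1, h2, hd, ⟨v, hv⟩, hle⟩ := exists_disjoint_split hl B S u (by omega)
  refine ⟨S₁, S₂, h1, h2, hd, by omega, ?_⟩
  obtain ⟨w, hw⟩ : (clus S₂ {v} ∩ B).Nonempty := Finset.card_pos.1 (by unfold cardIn at hv; omega)
  obtain ⟨hw1, hw2⟩ := Finset.mem_inter.1 hw
  refine ⟨w, hw2, ?_⟩
  rwa [cardIn, ← clus_eq_of_conn (mem_clus_singleton.1 hw1)]

/-- The hyperscaling step: having `3 l` points of `B` in a cluster forces, by the van den Berg–Kesten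
inequality, an independent copy of a cluster with `l` points of `B`. -/
theorem bernProb_three_mul_le {p : Sym2 V → ℝ} (hp : ∀ e, p e ∈ Set.Icc (0 : ℝ) 1)
    {F : Finset (Sym2 V)} {l : ℕ} (hl : 1 ≤ l) (B : Finset V) (u : V) {t : ℝ}
    (ht : ∀ v, bernProb p F (fun S => l ≤ (clus S {v}).card) ≤ t) :
    bernProb p F (fun S => 3 * l ≤ cardIn S B u) ≤
      bernProb p F (fun S => l ≤ cardIn S B u) * (B.card * t / l) := by
  have hinc : ∀ v, Increasing fun S : Finset (Sym2 V) => l ≤ cardIn S B v :=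
    fun v _ _ h hn => hn.trans (cardIn_mono h B v)
  have hincE : Increasing fun S : Finset (Sym2 V) => ∃ v ∈ B, l ≤ cardIn S B v :=
    fun _ _ h ⟨v, hv, hn⟩ => ⟨v, hv, hinc v h hn⟩
  refine (bernProb_le_of_imp hp fun S _ h => disjOcc_of_three_mul_le hl h).trans
    ((bernProb_disjOcc_le hp (hinc u) hincE).trans
      (mul_le_mul_of_nonneg_left ?_ (bernProb_nonneg hp _)))
  have hl0 : (0 : ℝ) < l := by exact_mod_cast hl
  rw [le_div_iff₀ hl0]
  -- Markov's inequality: a cluster with `l` points of `B` is seen from `l` points of `B`.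
  classical
  have h1 : bernProb p F (fun S => ∃ v ∈ B, l ≤ cardIn S B v) * l ≤
      ∑ v ∈ B, bernProb p F (fun S => l ≤ cardIn S B v) := by
    unfold bernProb
    rw [← bernExp_sum, mul_comm, ← bernExp_const_mul]
    refine bernExp_le hp fun S _ => ?_
    split_ifs with h
    · obtain ⟨v, hv, hvl⟩ := h
      rw [mul_one]
      refine (Nat.cast_le.2 hvl).trans ?_
      rw [cardIn, Finset.cast_card]
      refine (Finset.sum_le_sum fun w hw => ?_).trans (Finset.sum_le_sum_of_subset_of_nonneg
        Finset.inter_subset_right fun w _ _ => by split_ifs <;> norm_num)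
      have : l ≤ cardIn S B w := by
        rwa [cardIn, ← clus_eq_of_conn (mem_clus_singleton.1 (Finset.mem_inter.1 hw).1)]
      simp [this]
    · rw [mul_zero]
      exact Finset.sum_nonneg fun v _ => by split_ifs <;> norm_num
  refine h1.trans ((Finset.sum_le_sum fun v _ =>
    (bernProb_le_of_imp hp fun S _ h => h.trans cardIn_le_card_clus).trans (ht v)).trans ?_)
  rw [Finset.sum_const, nsmul_eq_mul]

/-- If `t` bounds the tail of the cluster size and `4 |B| t l ≤ l` from `M` on, the expected number
of points of `B` in a cluster is carried by the sizes below `3 M`. -/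
theorem bernExp_cardIn_le {p : Sym2 V → ℝ} (hp : ∀ e, p e ∈ Set.Icc (0 : ℝ) 1)
    {F : Finset (Sym2 V)} (B : Finset V) (u : V) {t : ℕ → ℝ}
    (ht : ∀ k v, bernProb p F (fun S => k ≤ (clus S {v}).card) ≤ t k) {M : ℕ} (hM : 1 ≤ M)
    (htM : ∀ l, M ≤ l → 4 * (B.card * t l) ≤ l) :
    bernExp p F (fun S => (cardIn S B u : ℝ)) ≤ 4 * ∑ k ∈ Finset.Icc 1 (3 * M), t k := by
  set g : ℕ → ℝ := fun k => bernProb p F (fun S => k ≤ cardIn S B u) with hg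
  have hg0 : ∀ k, 0 ≤ g k := fun k => bernProb_nonneg hp _
  have hgt : ∀ k, g k ≤ t k := fun k =>
    (bernProb_le_of_imp hp fun S _ h => h.trans cardIn_le_card_clus).trans (ht k u)
  have hganti : ∀ {j k}, j ≤ k → g k ≤ g j := fun h =>
    bernProb_le_of_imp hp fun S _ h' => h.trans h'
  have hg3 : ∀ l, M ≤ l → g (3 * l) ≤ g l / 4 := fun l hl => by
    have hl0 : (0 : ℝ) < l := by exact_mod_cast (hM.trans hl)
    have h1 := bernProb_three_mul_le hp (hM.trans hl) B u (ht l)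
    have h2 : B.card * t l / l ≤ 1 / 4 := by
      rw [div_le_div_iff₀ hl0 (by norm_num)]; linarith [htM l hl]
    calc g (3 * l) ≤ g l * (B.card * t l / l) := h1
      _ ≤ g l * (1 / 4) := mul_le_mul_of_nonneg_left h2 (hg0 l)
      _ = g l / 4 := by ring
  have hsum : bernExp p F (fun S => (cardIn S B u : ℝ)) =
      ∑ k ∈ Finset.Icc 1 (3 * (M + B.card)), g k := by
    have := bernExp_sum_Icc_eq (p := p) (F := F) (X := fun S => cardIn S B u)
      (K := 3 * (M + B.card)) (fun S _ => cardIn_le_card.trans (by omega)) (fun _ => 1)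
    simpa using this
  -- Cut the sum into blocks `{3 l + 1, 3 l + 2, 3 l + 3}`.
  have hblock : ∀ K, M ≤ K → ∑ k ∈ Finset.Icc 1 (3 * K), g k ≤
      ∑ k ∈ Finset.Icc 1 (3 * M), g k + 3 / 4 * ∑ k ∈ Finset.Ico M K, g k := by
    intro K hK
    induction K, hK using Nat.le_induction with
    | base => simp
    | succ K hK ih =>
      rw [Finset.sum_Ico_succ_top hK, show 3 * (K + 1) = 3 * K + 1 + 1 + 1 by ring,
        Finset.sum_Icc_succ_top (by omega), Finset.sum_Icc_succ_top (by omega),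
        Finset.sum_Icc_succ_top (by omega)]
      have h1 := hganti (show 3 * K ≤ 3 * K + 1 by omega)
      have h2 := hganti (show 3 * K ≤ 3 * K + 1 + 1 by omega)
      have h3 := hganti (show 3 * K ≤ 3 * K + 1 + 1 + 1 by omega)
      have := hg3 K hK
      linarith
  have h1 := hblock (M + B.card) (by omega)
  have h2 : ∑ k ∈ Finset.Ico M (M + B.card), g k ≤ ∑ k ∈ Finset.Icc 1 (3 * (M + B.card)), g k :=
    Finset.sum_le_sum_of_subset_of_nonneg (fun k hk => by
      simp only [Finset.mem_Ico, Finset.mem_Icc] at hk ⊢; omega) fun k _ _ => hg0 k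
  have h3 : ∑ k ∈ Finset.Icc 1 (3 * M), g k ≤ ∑ k ∈ Finset.Icc 1 (3 * M), t k :=
    Finset.sum_le_sum fun k _ => hgt k
  rw [hsum]
  linarith

end Clusters

/-! ### Exploration of a cluster: sharpness -/

section Exploration

variable {V : Type*} [DecidableEq V] {p q : Sym2 V → ℝ}

theorem card_clus_insert_le (S : Finset (Sym2 V)) (A : Finset V) (b : V) :
    (clus S (insert b A)).card ≤ (clus S A).card + (clus S {b}).card := by
  rw [clus_insert_vertex, add_comm]
  exact Finset.card_union_le _ _

theorem antitone_pow_card_clus {s : ℝ} (hs : s ∈ Set.Icc (0 : ℝ) 1) (A : Finset V) :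
    Antitone fun S : Finset (Sym2 V) => s ^ (clus S A).card := fun _ _ h =>
  pow_le_pow_of_le_one hs.1 hs.2 (Finset.card_le_card (clus_mono h A))

/-- Exploring a cluster in the percolation of parameter `p`, with the weight `s ^ |C|`, an unexplored
edge is always open with conditional probability at least `c p`, where `c` is a lower bound for
the mean weight of a single cluster. Hence the weighted law of the cluster dominates the law
of the cluster for any `q ≤ c p`. -/
theorem bernProb_mul_bernExp_pow_le (hp : ∀ e, p e ∈ Set.Icc (0 : ℝ) 1)
    (hq : ∀ e, q e ∈ Set.Icc (0 : ℝ) 1) {s c : ℝ} (hs : s ∈ Set.Icc (0 : ℝ) 1)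
    (hc : ∀ F y, c ≤ bernExp p F fun S => s ^ (clus S {y}).card) (hqp : ∀ e, q e ≤ c * p e)
    (n : ℕ) (F : Finset (Sym2 V)) (A : Finset V) :
    bernProb q F (fun S => n ≤ (clus S A).card) * bernExp p F (fun S => s ^ (clus S A).card) ≤
      bernExp p F (fun S => if n ≤ (clus S A).card then s ^ (clus S A).card else 0) := by
  induction F using Finset.strongInduction generalizing A with
  | H F ih =>
    by_cases hex : ∃ e ∈ F, Touches e A
    · obtain ⟨e, heF, a, ha, hae⟩ := hex
      obtain ⟨b, rfl⟩ := Sym2.mem_iff_exists.1 hae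
      have hins : insert s(a, b) (F.erase s(a, b)) = F := Finset.insert_erase heF
      set F' := F.erase s(a, b) with hF'
      have hne : s(a, b) ∉ F' := Finset.notMem_erase _ _
      have ih1 := ih F' (Finset.erase_ssubset heF) (insert b A)
      have ih0 := ih F' (Finset.erase_ssubset heF) A
      rw [← hins, bernProb_insert hne, bernExp_insert hne, bernExp_insert hne]
      simp only [clus_insert_edge ha]
      set u1 := bernProb q F' fun S => n ≤ (clus S (insert b A)).card
      set u0 := bernProb q F' fun S => n ≤ (clus S A).card
      set a1 := bernExp p F' fun S => s ^ (clus S (insert b A)).card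
      set a0 := bernExp p F' fun S => s ^ (clus S A).card
      have hmono : ∀ S : Finset (Sym2 V), (clus S A).card ≤ (clus S (insert b A)).card := fun S => by
        rw [clus_insert_vertex]; exact Finset.card_le_card Finset.subset_union_right
      have hu : u0 ≤ u1 := bernProb_le_of_imp hq fun S _ h => h.trans (hmono S)
      have ha10 : a1 ≤ a0 := bernExp_le hp fun S _ => pow_le_pow_of_le_one hs.1 hs.2 (hmono S)
      have ha0 : 0 ≤ a0 := bernExp_nonneg hp fun S _ => pow_nonneg hs.1 _
      have hca : c * a0 ≤ a1 := by
        calc c * a0 ≤ bernExp p F' (fun S => s ^ (clus S {b}).card) * a0 :=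
              mul_le_mul_of_nonneg_right (hc F' b) ha0
          _ ≤ bernExp p F' (fun S => s ^ (clus S {b}).card * s ^ (clus S A).card) :=
              bernExp_mul_le_bernExp_mul_of_antitone hp (antitone_pow_card_clus hs _)
                (antitone_pow_card_clus hs _)
          _ ≤ a1 := bernExp_le hp fun S _ => by
              rw [← pow_add, add_comm]
              exact pow_le_pow_of_le_one hs.1 hs.2 (card_clus_insert_le S A b)
      obtain ⟨hp0, hp1⟩ := hp s(a, b)
      obtain ⟨hq0, hq1⟩ := hq s(a, b)
      have k1 : q s(a, b) * (p s(a, b) * a1 + (1 - p s(a, b)) * a0) ≤ p s(a, b) * a1 := by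
        have e1 : p s(a, b) * a1 + (1 - p s(a, b)) * a0 ≤ a0 := by nlinarith
        have e2 := mul_le_mul_of_nonneg_left e1 hq0
        have e3 := mul_le_mul_of_nonneg_right (hqp s(a, b)) ha0
        have e4 := mul_le_mul_of_nonneg_left hca hp0
        linarith
      have k2 := mul_le_mul_of_nonneg_left k1 (sub_nonneg.2 hu)
      have k3 := mul_le_mul_of_nonneg_left ih1 hp0
      have k4 := mul_le_mul_of_nonneg_left ih0 (sub_nonneg.2 hp1)
      linarith
    · push Not at hex
      have hcl : ∀ S ⊆ F, clus S A = A := fun S hS => clus_eq_self fun e he => hex e (hS he)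
      have e1 : bernProb q F (fun S => n ≤ (clus S A).card) = if n ≤ A.card then 1 else 0 :=
        bernExp_eq_of_const fun S hS => by by_cases h : n ≤ A.card <;> simp [hcl S hS, h]
      have e2 : bernExp p F (fun S => s ^ (clus S A).card) = s ^ A.card :=
        bernExp_eq_of_const fun S hS => by rw [hcl S hS]
      have e3 : bernExp p F (fun S => if n ≤ (clus S A).card then s ^ (clus S A).card else 0) =
          if n ≤ A.card then s ^ A.card else 0 :=
        bernExp_eq_of_const fun S hS => by rw [hcl S hS]
      rw [e1, e2, e3]
      split_ifs <;> simp

/-- Exponential decay of the cluster size at parameter `q`. -/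
theorem bernProb_le_card_clus_le_pow (hp : ∀ e, p e ∈ Set.Icc (0 : ℝ) 1)
    (hq : ∀ e, q e ∈ Set.Icc (0 : ℝ) 1) {s c : ℝ} (hs : s ∈ Set.Icc (0 : ℝ) 1)
    (hc : ∀ F y, c ≤ bernExp p F fun S => s ^ (clus S {y}).card) (hqp : ∀ e, q e ≤ c * p e)
    (n : ℕ) (F : Finset (Sym2 V)) (x : V) :
    c * bernProb q F (fun S => n ≤ (clus S {x}).card) ≤ s ^ n := by
  calc c * bernProb q F (fun S => n ≤ (clus S {x}).card)
      ≤ bernProb q F (fun S => n ≤ (clus S {x}).card) *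
        bernExp p F (fun S => s ^ (clus S {x}).card) := by
        rw [mul_comm]
        exact mul_le_mul_of_nonneg_left (hc F x) (bernProb_nonneg hq _)
    _ ≤ bernExp p F (fun S => if n ≤ (clus S {x}).card then s ^ (clus S {x}).card else 0) :=
        bernProb_mul_bernExp_pow_le hp hq hs hc hqp n F {x}
    _ ≤ bernExp p F (fun _ => s ^ n) := bernExp_le hp fun S _ => by
        split_ifs with h
        · exact pow_le_pow_of_le_one hs.1 hs.2 h
        · exact pow_nonneg hs.1 n
    _ = s ^ n := bernExp_const _

/-! ### Exploration of a cluster: fluctuations of the boundary -/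

/-- The weighted difference between the expected and the actual number of open edges among the
edges of `F` that touch `C`. -/
def imbalance (p u : Sym2 V → ℝ) (F S : Finset (Sym2 V)) (C : Finset V) : ℝ :=
  ∑ e ∈ F with Touches e C, u e * (p e - if e ∈ S then 1 else 0)

variable {u : Sym2 V → ℝ} {F : Finset (Sym2 V)}

/-- The sum of the variances of the terms of `imbalance` belonging to edges that touch `A`. -/
def varAt (p u : Sym2 V → ℝ) (F : Finset (Sym2 V)) (A : Finset V) : ℝ :=
  ∑ e ∈ F with Touches e A, u e ^ 2 * (p e * (1 - p e))

theorem varAt_term_nonneg {V : Type*} {p u : Sym2 V → ℝ} (hp : ∀ e, p e ∈ Set.Icc (0 : ℝ) 1) (e : Sym2 V) :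
    0 ≤ u e ^ 2 * (p e * (1 - p e)) :=
  mul_nonneg (sq_nonneg _) (mul_nonneg (hp e).1 (sub_nonneg.2 (hp e).2))

theorem varAt_mono (hp : ∀ e, p e ∈ Set.Icc (0 : ℝ) 1) {F' : Finset (Sym2 V)} (h : F' ⊆ F)
    (A : Finset V) : varAt p u F' A ≤ varAt p u F A :=
  Finset.sum_le_sum_of_subset_of_nonneg (Finset.filter_subset_filter _ h)
    fun e _ _ => varAt_term_nonneg hp e

theorem varAt_insert_vertex_le (hp : ∀ e, p e ∈ Set.Icc (0 : ℝ) 1) (A : Finset V) (b : V) :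
    varAt p u F (insert b A) ≤ varAt p u F A + varAt p u F {b} := by
  unfold varAt
  rw [← Finset.sum_union_inter]
  refine le_trans (Finset.sum_le_sum_of_subset_of_nonneg ?_ fun e _ _ => varAt_term_nonneg hp e)
    (le_add_of_nonneg_right (Finset.sum_nonneg fun e _ => varAt_term_nonneg hp e))
  intro e he
  obtain ⟨heF, v, hv, hve⟩ := Finset.mem_filter.1 he
  rw [Finset.mem_union, Finset.mem_filter, Finset.mem_filter]
  rcases Finset.mem_insert.1 hv with rfl | hv
  · exact Or.inr ⟨heF, v, Finset.mem_singleton_self v, hve⟩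
  · exact Or.inl ⟨heF, v, hv, hve⟩

/-- When a cluster is explored edge by edge, its imbalance is a martingale. Each vertex
contributes at most `v` to the quadratic variation, and the edges of the `k`-th vertex are examined
when at least `k` vertices are present, so for a decreasing weight `w` they
contribute at most `v * w k` to the weighted second moment. -/
theorem bernExp_imbalance_sq_le (hp : ∀ e, p e ∈ Set.Icc (0 : ℝ) 1) {w : ℕ → ℝ}
    (hw0 : ∀ k, 0 ≤ w k) (hw : ∀ j k, 1 ≤ j → j ≤ k → w k ≤ w j) {v : ℝ}
    (hv : ∀ b, varAt p u F {b} ≤ v) (A : Finset V) (hA : A.Nonempty) (H : ℝ) :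
    bernExp p F (fun S => (H + imbalance p u F S (clus S A)) ^ 2 * w (clus S A).card) ≤
      w A.card * (H ^ 2 + varAt p u F A) +
        bernExp p F (fun S => ∑ k ∈ Finset.Ioc A.card (clus S A).card, v * w k) := by
  induction F using Finset.strongInduction generalizing A H with
  | H F ih =>
    by_cases hex : ∃ e ∈ F, Touches e A
    · obtain ⟨e, heF, a, ha, hae⟩ := hex
      obtain ⟨b, rfl⟩ := Sym2.mem_iff_exists.1 hae
      have hins : insert s(a, b) (F.erase s(a, b)) = F := Finset.insert_erase heF
      set F' := F.erase s(a, b) with hF'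
      have hne : s(a, b) ∉ F' := Finset.notMem_erase _ _
      have hv' : ∀ b, varAt p u F' {b} ≤ v := fun b =>
        (varAt_mono hp (Finset.erase_subset _ _) _).trans (hv b)
      set P := p s(a, b) with hP
      set U := u s(a, b) with hU
      obtain ⟨hp0, hp1⟩ := hp s(a, b)
      have ih1 := ih F' (Finset.erase_ssubset heF) hv' (insert b A) (Finset.insert_nonempty _ _)
        (H + U * (P - 1))
      have ih0 := ih F' (Finset.erase_ssubset heF) hv' A hA (H + U * P)
      have htouch : ∀ S : Finset (Sym2 V), Touches s(a, b) (clus S A) := fun S =>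
        ⟨a, subset_clus S A ha, Sym2.mem_mk_left a b⟩
      have htouch' : ∀ S : Finset (Sym2 V), Touches s(a, b) (clus S (insert b A)) := fun S =>
        ⟨a, subset_clus S _ (Finset.mem_insert_of_mem ha), Sym2.mem_mk_left a b⟩
      have himb1 : ∀ S, imbalance p u (insert s(a, b) F') (insert s(a, b) S)
          (clus S (insert b A)) = U * (P - 1) + imbalance p u F' S (clus S (insert b A)) := by
        intro S
        unfold imbalance
        rw [Finset.filter_insert, if_pos (htouch' S), Finset.sum_insert (by simp [hne])]
        congr 1
        · simp [hP, hU]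
        · refine Finset.sum_congr rfl fun e he => ?_
          have : e ≠ s(a, b) := fun h => hne (h ▸ (Finset.mem_filter.1 he).1)
          simp [this]
      have himb0 : ∀ S ⊆ F', imbalance p u (insert s(a, b) F') S (clus S A) =
          U * P + imbalance p u F' S (clus S A) := by
        intro S hS
        unfold imbalance
        rw [Finset.filter_insert, if_pos (htouch S), Finset.sum_insert (by simp [hne]),
          if_neg fun h => hne (hS h), sub_zero]
      have hvar : varAt p u (insert s(a, b) F') A = U ^ 2 * (P * (1 - P)) + varAt p u F' A := by
        unfold varAt
        rw [Finset.filter_insert, if_pos ⟨a, ha, Sym2.mem_mk_left a b⟩,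
          Finset.sum_insert (by simp [hne])]
      have hstep : w (insert b A).card * ((H + U * (P - 1)) ^ 2 + varAt p u F' (insert b A)) +
            bernExp p F' (fun S => ∑ k ∈ Finset.Ioc (insert b A).card (clus S (insert b A)).card,
              v * w k) ≤
          w A.card * ((H + U * (P - 1)) ^ 2 + varAt p u F' A) +
            bernExp p F' (fun S => ∑ k ∈ Finset.Ioc A.card (clus S (insert b A)).card,
              v * w k) := by
        by_cases hb : b ∈ A
        · rw [Finset.insert_eq_of_mem hb]
        · have hcard := Finset.card_insert_of_notMem hb
          have h1 : bernExp p F' (fun S => ∑ k ∈ Finset.Ioc A.card (clus S (insert b A)).card,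
              v * w k) = v * w (insert b A).card + bernExp p F' (fun S =>
                ∑ k ∈ Finset.Ioc (insert b A).card (clus S (insert b A)).card, v * w k) := by
            rw [← bernExp_const (p := p) (F := F') (v * w (insert b A).card), ← bernExp_add]
            refine bernExp_congr fun S _ => ?_
            have hle : (insert b A).card ≤ (clus S (insert b A)).card :=
              Finset.card_le_card (subset_clus S _)
            rw [hcard] at hle ⊢
            rw [← Finset.sum_insert (f := fun k => v * w k) (s := Finset.Ioc (A.card + 1) _)
              (a := A.card + 1) (by simp)]
            congr 1
            ext k
            simp only [Finset.mem_insert, Finset.mem_Ioc]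
            omega
          have h2 := varAt_insert_vertex_le (F := F') (u := u) hp A b
          have h3 := hv' b
          have h4 : w (insert b A).card ≤ w A.card :=
            hw _ _ (Finset.card_pos.2 hA) (by omega)
          have h5 : 0 ≤ varAt p u F' A := Finset.sum_nonneg fun e _ => varAt_term_nonneg hp e
          have h6 := mul_le_mul_of_nonneg_right h4
            (add_nonneg (sq_nonneg (H + U * (P - 1))) h5)
          have h7 := mul_le_mul_of_nonneg_left
            (show (H + U * (P - 1)) ^ 2 + varAt p u F' (insert b A) ≤
              (H + U * (P - 1)) ^ 2 + varAt p u F' A + v by linarith) (hw0 (insert b A).card)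
          rw [h1]
          linarith
      rw [← hins, bernExp_insert hne, bernExp_insert hne, hvar]
      simp only [clus_insert_edge ha, himb1]
      rw [bernExp_congr (f := fun S => (H + imbalance p u (insert s(a, b) F') S (clus S A)) ^ 2 *
          w (clus S A).card) (g := fun S => (H + U * P + imbalance p u F' S (clus S A)) ^ 2 *
          w (clus S A).card) fun S hS => by rw [himb0 S hS, add_assoc]]
      simp only [← add_assoc]
      have k1 := mul_le_mul_of_nonneg_left (ih1.trans hstep) hp0
      have k0 := mul_le_mul_of_nonneg_left ih0 (sub_nonneg.2 hp1)
      rw [← hP] at k1 k0 ⊢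
      linarith
    · push Not at hex
      have hcl : ∀ S ⊆ F, clus S A = A := fun S hS => clus_eq_self fun e he => hex e (hS he)
      have hfil : (F.filter fun e => Touches e A) = ∅ :=
        Finset.filter_eq_empty_iff.2 fun e he => hex e he
      have e1 : bernExp p F (fun S => (H + imbalance p u F S (clus S A)) ^ 2 *
          w (clus S A).card) = H ^ 2 * w A.card := bernExp_eq_of_const fun S hS => by
        rw [hcl S hS, imbalance, hfil, Finset.sum_empty, add_zero]
      have e2 : bernExp p F (fun S => ∑ k ∈ Finset.Ioc A.card (clus S A).card, v * w k) = 0 :=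
        bernExp_eq_of_const fun S hS => by rw [hcl S hS, Finset.Ioc_self, Finset.sum_empty]
      rw [e1, e2, varAt, hfil]
      simp [mul_comm]

theorem bernExp_abs_imbalance_div_le (hp : ∀ e, p e ∈ Set.Icc (0 : ℝ) 1) {v : ℝ} (hv0 : 0 < v)
    (hv : ∀ b, varAt p u F {b} ≤ v) (n : ℕ) (hn : 1 ≤ n) (x : V) :
    bernExp p F (fun S => |imbalance p u F S (clus S {x})| / max ((clus S {x}).card : ℝ) n) ≤
      √v * bernExp p F (fun S => ∑ k ∈ Finset.Icc 1 (clus S {x}).card,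
        1 / (√k * max (k : ℝ) n)) := by
  set w : ℕ → ℝ := fun k => 1 / (√k * max (k : ℝ) n) with hw
  have hn' : (1 : ℝ) ≤ n := by exact_mod_cast hn
  have hmax : ∀ k : ℕ, 0 < max (k : ℝ) n := fun k => lt_of_lt_of_le (by linarith) (le_max_right _ _)
  have hw0 : ∀ k, 0 ≤ w k := fun k => by
    have := hmax k
    simp only [hw]; positivity
  have hwanti : ∀ j k, 1 ≤ j → j ≤ k → w k ≤ w j := fun j k hj hjk => by
    have hj' : (0 : ℝ) < j := by exact_mod_cast hj
    have hjk' : (j : ℝ) ≤ k := by exact_mod_cast hjk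
    have := hmax j
    refine one_div_le_one_div_of_le (by positivity) ?_
    exact mul_le_mul (Real.sqrt_le_sqrt hjk') (max_le_max_right _ hjk') this.le (Real.sqrt_nonneg _)
  set W := bernExp p F (fun S => ∑ k ∈ Finset.Icc 1 (clus S {x}).card, w k) with hW
  have h1 : bernExp p F (fun S => imbalance p u F S (clus S {x}) ^ 2 * w (clus S {x}).card) ≤
      v * W := by
    have := bernExp_imbalance_sq_le (u := u) hp hw0 hwanti hv {x} (Finset.singleton_nonempty x) 0
    simp only [zero_add, Finset.card_singleton] at this
    refine this.trans ?_
    have h2 : w 1 * (0 ^ 2 + varAt p u F {x}) ≤ v * w 1 := by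
      have := mul_le_mul_of_nonneg_left (hv x) (hw0 1)
      linarith
    refine (add_le_add_left h2 _).trans (le_of_eq ?_)
    rw [hW, ← bernExp_const_mul, ← bernExp_const (p := p) (F := F) (v * w 1), ← bernExp_add]
    refine bernExp_congr fun S _ => ?_
    have := card_clus_pos S x
    rw [← Finset.mul_sum, ← mul_add, ← Finset.sum_insert (f := w) (by simp)]
    congr 2
    ext k
    simp only [Finset.mem_insert, Finset.mem_Ioc, Finset.mem_Icc]
    omega
  have hsv : 0 < √v := Real.sqrt_pos.2 hv0
  have h3 : bernExp p F (fun S => √((clus S {x}).card : ℝ) / max ((clus S {x}).card : ℝ) n) ≤ W := by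
    refine bernExp_le hp fun S _ => ?_
    set N := (clus S {x}).card with hN
    have hN0 : (0 : ℝ) < N := by exact_mod_cast card_clus_pos S x
    have hNs := Real.sqrt_pos.2 hN0
    have := Finset.card_nsmul_le_sum (Finset.Icc 1 N) w (w N) fun k hk =>
      hwanti k N (Finset.mem_Icc.1 hk).1 (Finset.mem_Icc.1 hk).2
    refine le_trans (le_of_eq ?_) this
    have hm := hmax N
    rw [Nat.card_Icc, Nat.add_sub_cancel, nsmul_eq_mul]
    simp only [hw]
    field_simp
    exact Real.sq_sqrt hN0.le
  have h4 : bernExp p F (fun S => |imbalance p u F S (clus S {x})| / max ((clus S {x}).card : ℝ) n)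
      ≤ 1 / (2 * √v) * bernExp p F (fun S => imbalance p u F S (clus S {x}) ^ 2 *
        w (clus S {x}).card) + √v / 2 * bernExp p F (fun S => √((clus S {x}).card : ℝ) /
          max ((clus S {x}).card : ℝ) n) := by
    rw [← bernExp_const_mul, ← bernExp_const_mul, ← bernExp_add]
    refine bernExp_le hp fun S _ => ?_
    set N := (clus S {x}).card with hN
    have hN0 : (0 : ℝ) < N := by exact_mod_cast card_clus_pos S x
    have hNs := Real.sqrt_pos.2 hN0
    have hm := hmax N
    set h := imbalance p u F S (clus S {x})
    have e : 1 / (2 * √v) * (h ^ 2 * w N) + √v / 2 * (√(N : ℝ) / max (N : ℝ) n) -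
        |h| / max (N : ℝ) n = (|h| - √v * √(N : ℝ)) ^ 2 / (2 * √v * √(N : ℝ) * max (N : ℝ) n) := by
      simp only [hw]
      rw [← sq_abs h]
      field_simp
      ring
    have : 0 ≤ (|h| - √v * √(N : ℝ)) ^ 2 / (2 * √v * √(N : ℝ) * max (N : ℝ) n) := by positivity
    linarith
  refine h4.trans ?_
  have h5 := mul_le_mul_of_nonneg_left h1 (show 0 ≤ 1 / (2 * √v) by positivity)
  have h6 := mul_le_mul_of_nonneg_left h3 (show 0 ≤ √v / 2 by positivity)
  have h7 : 1 / (2 * √v) * (v * W) = √v / 2 * W := by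
    nth_rw 2 [← Real.mul_self_sqrt hv0.le]
    field_simp
  linarith

end Exploration

/-! ### The two-ghost inequality -/

section TwoGhost

variable {V : Type*} [DecidableEq V] {p u : Sym2 V → ℝ} {F : Finset (Sym2 V)}

/-- The endpoints of `e` lie in distinct clusters with at least `n` vertices each. -/
def TwoLarge (n : ℕ) (e : Sym2 V) (S : Finset (Sym2 V)) : Prop :=
  ∃ x y, e = s(x, y) ∧ n ≤ (clus S {x}).card ∧ n ≤ (clus S {y}).card ∧ ¬ Conn S x y

theorem not_twoLarge_of_mem {n : ℕ} {e : Sym2 V} {S : Finset (Sym2 V)} (he : e ∈ S) :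
    ¬ TwoLarge n e S := by
  rintro ⟨x, y, rfl, -, -, h⟩
  exact h (Conn.of_mem he)

/-- The sum over the clusters `C` touching `e` of `|C| / max |C| n`, written as a sum over their
vertices. -/
noncomputable def ghostSum (Λ : Finset V) (n : ℕ) (e : Sym2 V) (S : Finset (Sym2 V)) : ℝ :=
  ∑ x ∈ Λ with Touches e (clus S {x}), 1 / max ((clus S {x}).card : ℝ) n

theorem sum_clus_ghost (S : Finset (Sym2 V)) (n : ℕ) (a : V) :
    ∑ x ∈ clus S {a}, 1 / max ((clus S {x}).card : ℝ) n =
      (clus S {a}).card / max ((clus S {a}).card : ℝ) n := by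
  rw [Finset.sum_congr rfl fun x hx => by rw [← clus_eq_of_conn (mem_clus_singleton.1 hx)],
    Finset.sum_const, nsmul_eq_mul, mul_one_div]

theorem ghostSum_eq {Λ : Finset V} {n : ℕ} {a b : V} {S : Finset (Sym2 V)}
    (ha : clus S {a} ⊆ Λ) (hb : clus S {b} ⊆ Λ) :
    ghostSum Λ n s(a, b) S =
      ∑ x ∈ clus S {a} ∪ clus S {b}, 1 / max ((clus S {x}).card : ℝ) n := by
  refine Finset.sum_congr ?_ fun _ _ => rfl
  ext x
  rw [Finset.mem_filter, Finset.mem_union, mem_clus_singleton, mem_clus_singleton]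
  simp only [Touches, Sym2.mem_iff, mem_clus_singleton]
  constructor
  · rintro ⟨-, v, hv, rfl | rfl⟩
    exacts [Or.inl hv.symm, Or.inr hv.symm]
  · rintro (h | h)
    · exact ⟨ha (mem_clus_singleton.2 h), a, h.symm, Or.inl rfl⟩
    · exact ⟨hb (mem_clus_singleton.2 h), b, h.symm, Or.inr rfl⟩

open Classical in
/-- Opening `e` merges two clusters; as `k ↦ k / max k n` is subadditive this decreases the
sum over the clusters touching `e`, and decreases it by `1` if both clusters are large. -/
theorem ghostSum_insert_le {Λ : Finset V} {n : ℕ} (hn : 1 ≤ n) {e : Sym2 V} {S : Finset (Sym2 V)}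
    (hΛ : ∀ a ∈ e, clus S {a} ⊆ Λ) :
    (if TwoLarge n e S then 1 else 0) ≤ ghostSum Λ n e S - ghostSum Λ n e (insert e S) := by
  induction e with
  | h a b =>
  have ha := hΛ a (Sym2.mem_mk_left a b)
  have hb := hΛ b (Sym2.mem_mk_right a b)
  have hcl : clus (insert s(a, b) S) {a} = clus S {a} ∪ clus S {b} := clus_insert_edge_singleton
  have hab : Conn (insert s(a, b) S) a b := Conn.of_mem (Finset.mem_insert_self _ _)
  have hΛ' : clus (insert s(a, b) S) {a} ⊆ Λ := by
    rw [hcl]; exact Finset.union_subset ha hb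
  have h1 : ghostSum Λ n s(a, b) (insert s(a, b) S) =
      (clus S {a} ∪ clus S {b}).card / max ((clus S {a} ∪ clus S {b}).card : ℝ) n := by
    rw [ghostSum_eq hΛ' (clus_eq_of_conn hab ▸ hΛ'), ← clus_eq_of_conn hab, Finset.union_self,
      sum_clus_ghost, hcl]
  have hn' : (1 : ℝ) ≤ n := by exact_mod_cast hn
  by_cases hc : Conn S a b
  · have hno : ¬ TwoLarge n s(a, b) S := by
      rintro ⟨x, y, hxy, -, -, hne⟩
      rcases Sym2.eq_iff.1 hxy with ⟨rfl, rfl⟩ | ⟨rfl, rfl⟩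
      exacts [hne hc, hne hc.symm]
    rw [if_neg hno, h1, ghostSum_eq ha hb, ← clus_eq_of_conn hc, Finset.union_self,
      sum_clus_ghost, sub_self]
  · have hd := disjoint_clus hc
    rw [h1, ghostSum_eq ha hb, Finset.sum_union hd, sum_clus_ghost, sum_clus_ghost,
      Finset.card_union_of_disjoint hd]
    have hka := card_clus_pos S a
    have hkb := card_clus_pos S b
    have hlarge : TwoLarge n s(a, b) S → n ≤ (clus S {a}).card ∧ n ≤ (clus S {b}).card := by
      rintro ⟨x, y, hxy, h2, h3, -⟩
      rcases Sym2.eq_iff.1 hxy with ⟨rfl, rfl⟩ | ⟨rfl, rfl⟩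
      exacts [⟨h2, h3⟩, ⟨h3, h2⟩]
    generalize (clus S {a}).card = k at *
    generalize (clus S {b}).card = l at *
    have hk0 : (0 : ℝ) < k := by exact_mod_cast hka
    have hl0 : (0 : ℝ) < l := by exact_mod_cast hkb
    push_cast
    split_ifs with h
    · obtain ⟨h2, h3⟩ := hlarge h
      have h2' : (n : ℝ) ≤ k := by exact_mod_cast h2
      have h3' : (n : ℝ) ≤ l := by exact_mod_cast h3
      rw [max_eq_left h2', max_eq_left h3', max_eq_left (by linarith), div_self hk0.ne',
        div_self hl0.ne', div_self (by linarith)]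
      norm_num
    · have e1 : (k : ℝ) / max ((k : ℝ) + l) n ≤ k / max (k : ℝ) n :=
        div_le_div_of_nonneg_left hk0.le (lt_max_of_lt_left hk0)
          (max_le_max_right _ (by linarith))
      have e2 : (l : ℝ) / max ((k : ℝ) + l) n ≤ l / max (l : ℝ) n :=
        div_le_div_of_nonneg_left hl0.le (lt_max_of_lt_left hl0)
          (max_le_max_right _ (by linarith))
      rw [add_div]
      linarith

theorem clus_subset_of_edges {Λ : Finset V} {S : Finset (Sym2 V)} (hS : S ⊆ F)
    (hΛ : ∀ e ∈ F, ∀ v ∈ e, v ∈ Λ) {a : V} (ha : a ∈ Λ) : clus S {a} ⊆ Λ :=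
  clus_subset_of_closed (by simpa using ha) fun _ _ _ h => hΛ _ (hS h) _ (Sym2.mem_mk_right _ _)

/-- The two-ghost inequality: the edges joining distinct large clusters are controlled by the
fluctuations of the number of open edges at the clusters. -/
theorem sum_twoLarge_le (hp : ∀ e, p e ∈ Set.Icc (0 : ℝ) 1) (hu : ∀ e, 0 ≤ u e) {Λ : Finset V}
    (hΛ : ∀ e ∈ F, ∀ v ∈ e, v ∈ Λ) {n : ℕ} (hn : 1 ≤ n) :
    ∑ e ∈ F, u e * p e * bernProb p F (TwoLarge n e) ≤
      ∑ x ∈ Λ, bernExp p F (fun S =>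
        |imbalance p u F S (clus S {x})| / max ((clus S {x}).card : ℝ) n) := by
  classical
  have hedge : ∀ e ∈ F, u e * p e * bernProb p F (TwoLarge n e) ≤
      bernExp p F (fun S => u e * (p e - if e ∈ S then 1 else 0) * ghostSum Λ n e S) := by
    intro e he
    obtain ⟨hp0, hp1⟩ := hp e
    have hne : e ∉ F.erase e := Finset.notMem_erase _ _
    have hins : insert e (F.erase e) = F := Finset.insert_erase he
    rw [← hins, bernProb_insert hne, bernExp_insert hne]
    have h1 : bernProb p (F.erase e) (fun S => TwoLarge n e (insert e S)) = 0 :=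
      bernExp_eq_of_const fun S _ => if_neg (not_twoLarge_of_mem (Finset.mem_insert_self _ _))
    have h2 : bernExp p (F.erase e) (fun S => u e * (p e - if e ∈ insert e S then 1 else 0) *
        ghostSum Λ n e (insert e S)) = u e * (p e - 1) *
          bernExp p (F.erase e) (fun S => ghostSum Λ n e (insert e S)) := by
      rw [← bernExp_const_mul]
      exact bernExp_congr fun S _ => by simp
    have h3 : bernExp p (F.erase e) (fun S => u e * (p e - if e ∈ S then 1 else 0) *
        ghostSum Λ n e S) = u e * p e * bernExp p (F.erase e) (fun S => ghostSum Λ n e S) := by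
      rw [← bernExp_const_mul]
      exact bernExp_congr fun S hS => by rw [if_neg fun h => hne (hS h), sub_zero]
    have h4 : bernProb p (F.erase e) (TwoLarge n e) ≤
        bernExp p (F.erase e) (fun S => ghostSum Λ n e S) -
          bernExp p (F.erase e) (fun S => ghostSum Λ n e (insert e S)) := by
      rw [← bernExp_sub]
      refine bernExp_le hp fun S hS => ghostSum_insert_le hn fun a ha => ?_
      exact clus_subset_of_edges (hS.trans (Finset.erase_subset _ _)) hΛ (hΛ e he a ha)
    rw [h1, h2, h3]
    have h5 := mul_le_mul_of_nonneg_left h4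
      (mul_nonneg (mul_nonneg (hu e) hp0) (sub_nonneg.2 hp1))
    linarith
  refine (Finset.sum_le_sum hedge).trans ?_
  rw [← bernExp_sum, ← bernExp_sum]
  refine bernExp_le hp fun S _ => ?_
  have h6 : ∑ e ∈ F, u e * (p e - if e ∈ S then 1 else 0) * ghostSum Λ n e S =
      ∑ x ∈ Λ, imbalance p u F S (clus S {x}) / max ((clus S {x}).card : ℝ) n := by
    simp only [ghostSum, imbalance, Finset.mul_sum, Finset.sum_div, Finset.sum_filter]
    rw [Finset.sum_comm]
    refine Finset.sum_congr rfl fun x _ => Finset.sum_congr rfl fun e _ => ?_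
    split_ifs <;> ring
  rw [h6]
  refine Finset.sum_le_sum fun x _ => ?_
  exact div_le_div_of_nonneg_right (le_abs_self _) (le_max_of_le_left (Nat.cast_nonneg _))

/-- The two-ghost inequality, with the fluctuations expressed through a bound `t` on the tail of the
cluster size. -/
theorem sum_twoLarge_le_of_tail (hp : ∀ e, p e ∈ Set.Icc (0 : ℝ) 1) (hu : ∀ e, 0 ≤ u e)
    {Λ : Finset V} (hΛ : ∀ e ∈ F, ∀ v ∈ e, v ∈ Λ) {n : ℕ} (hn : 1 ≤ n) {v : ℝ} (hv0 : 0 < v)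
    (hv : ∀ b, varAt p u F {b} ≤ v) {t : ℕ → ℝ}
    (ht : ∀ k x, bernProb p F (fun S => k ≤ (clus S {x}).card) ≤ t k) {T : ℝ}
    (hT : ∀ K, ∑ k ∈ Finset.Icc (1 : ℕ) K, 1 / (√(k : ℝ) * max (k : ℝ) n) * t k ≤ T) :
    ∑ e ∈ F, u e * p e * bernProb p F (TwoLarge n e) ≤ Λ.card * (√v * T) := by
  refine (sum_twoLarge_le hp hu hΛ hn).trans ?_
  rw [← nsmul_eq_mul]
  refine Finset.sum_le_card_nsmul _ _ _ fun x hx => ?_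
  refine (bernExp_abs_imbalance_div_le hp hv0 hv n hn x).trans
    (mul_le_mul_of_nonneg_left ?_ (Real.sqrt_nonneg v))
  rw [bernExp_sum_Icc_eq (K := Λ.card) fun S hS =>
    Finset.card_le_card (clus_subset_of_edges hS hΛ hx)]
  exact (Finset.sum_le_sum fun k _ => mul_le_mul_of_nonneg_left (ht k x) (by positivity)).trans
    (hT _)

end TwoGhost

/-! ### Translation invariance and averaging over large cubes -/

section Lattice

variable {d : ℕ} {p u : Sym2 (Fin d → ℤ) → ℝ}

theorem bernExp_cardIn_eq {V : Type*} [DecidableEq V] (p : Sym2 V → ℝ) (F : Finset (Sym2 V))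
    (B : Finset V) (x : V) :
    bernExp p F (fun S => (cardIn S B x : ℝ)) = ∑ z ∈ B, bernProb p F (fun S => Conn S x z) := by
  classical
  unfold bernProb
  rw [← bernExp_sum]
  refine bernExp_congr fun S _ => ?_
  rw [Finset.sum_ite, Finset.sum_const_zero, add_zero, Finset.sum_const, nsmul_eq_mul, mul_one,
    cardIn]
  congr 2
  ext z
  simp [and_comm]

/-- Translation of unordered pairs by `v`. -/
def shift (v : Fin d → ℤ) : Sym2 (Fin d → ℤ) ↪ Sym2 (Fin d → ℤ) :=
  ⟨Sym2.map (v + ·), Sym2.map.injective (add_right_injective v)⟩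

@[simp] theorem shift_mk (v x y : Fin d → ℤ) : shift v s(x, y) = s(v + x, v + y) := rfl

theorem map_shift_neg (v : Fin d → ℤ) (S : Finset (Sym2 (Fin d → ℤ))) :
    (S.map (shift v)).map (shift (-v)) = S := by
  rw [Finset.map_map]
  convert Finset.map_refl using 2
  ext e
  induction e with
  | h x y => simp

theorem Conn.map_shift {S : Finset (Sym2 (Fin d → ℤ))} {x y : Fin d → ℤ} (h : Conn S x y)
    (v : Fin d → ℤ) : Conn (S.map (shift v)) (v + x) (v + y) :=
  h.induct (P := fun y => Conn (S.map (shift v)) (v + x) (v + y)) (Conn.refl _ _)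
    fun a b _ ih hab => ih.trans (Conn.of_mem (by
      rw [← shift_mk]; exact Finset.mem_map_of_mem _ hab))

theorem card_clus_map_shift (S : Finset (Sym2 (Fin d → ℤ))) (v x : Fin d → ℤ) :
    (clus (S.map (shift v)) {v + x}).card = (clus S {x}).card := by
  have key : ∀ (S : Finset (Sym2 (Fin d → ℤ))) (v x : Fin d → ℤ),
      (clus S {x}).card ≤ (clus (S.map (shift v)) {v + x}).card := by
    intro S v x
    rw [← Finset.card_map (addLeftEmbedding v)]
    refine Finset.card_le_card fun y hy => ?_
    obtain ⟨z, hz, rfl⟩ := Finset.mem_map.1 hy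
    exact mem_clus_singleton.2 ((mem_clus_singleton.1 hz).map_shift v)
  refine le_antisymm ?_ (key S v x)
  have := key (S.map (shift v)) (-v) (v + x)
  rwa [map_shift_neg, neg_add_cancel_left] at this

theorem bernProb_map_shift (hinv : ∀ v e, p (shift v e) = p e) (F : Finset (Sym2 (Fin d → ℤ)))
    (k : ℕ) (v x : Fin d → ℤ) :
    bernProb p (F.map (shift v)) (fun S => k ≤ (clus S {v + x}).card) =
      bernProb p F (fun S => k ≤ (clus S {x}).card) := by
  classical
  unfold bernProb
  rw [bernExp_map, show p ∘ shift v = p from funext (hinv v)]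
  refine bernExp_congr fun S _ => ?_
  by_cases h : k ≤ (clus S {x}).card <;> simp [card_clus_map_shift, h]

/-- The probability that the cluster of the origin has at least `k` vertices, as a supremum
over finite edge sets. -/
noncomputable def tail (p : Sym2 (Fin d → ℤ) → ℝ) (k : ℕ) : ℝ :=
  ⨆ F : Finset (Sym2 (Fin d → ℤ)), bernProb p F (fun S => k ≤ (clus S {0}).card)

theorem bddAbove_tail (hp : ∀ e, p e ∈ Set.Icc (0 : ℝ) 1) (k : ℕ) :
    BddAbove (Set.range fun F : Finset (Sym2 (Fin d → ℤ)) =>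
      bernProb p F (fun S => k ≤ (clus S {0}).card)) :=
  ⟨1, by rintro _ ⟨F, rfl⟩; exact bernProb_le_one hp _⟩

theorem bernProb_le_tail (hp : ∀ e, p e ∈ Set.Icc (0 : ℝ) 1) (hinv : ∀ v e, p (shift v e) = p e)
    (F : Finset (Sym2 (Fin d → ℤ))) (k : ℕ) (x : Fin d → ℤ) :
    bernProb p F (fun S => k ≤ (clus S {x}).card) ≤ tail p k := by
  rw [← bernProb_map_shift hinv F k (-x) x, neg_add_cancel]
  exact le_ciSup (bddAbove_tail hp k) _

theorem tail_nonneg (hp : ∀ e, p e ∈ Set.Icc (0 : ℝ) 1) (k : ℕ) : 0 ≤ tail p k :=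
  (bernProb_nonneg hp _).trans (le_ciSup (bddAbove_tail hp k) ∅)

theorem tail_le_one (hp : ∀ e, p e ∈ Set.Icc (0 : ℝ) 1) (k : ℕ) : tail p k ≤ 1 :=
  ciSup_le fun _ => bernProb_le_one hp _

theorem tail_one (hp : ∀ e, p e ∈ Set.Icc (0 : ℝ) 1) : tail p 1 = 1 := by
  refine le_antisymm (tail_le_one hp 1) ?_
  refine le_trans (le_of_eq ?_) (le_ciSup (bddAbove_tail hp 1) ∅)
  exact (bernExp_eq_of_const fun S _ => if_pos (card_clus_pos S 0)).symm

/-- The cube `[-N, N]^d`. -/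
noncomputable def cube (d N : ℕ) : Finset (Fin d → ℤ) := Finset.Icc (fun _ => -(N : ℤ)) (fun _ => (N : ℤ))

theorem mem_cube {N : ℕ} {x : Fin d → ℤ} : x ∈ cube d N ↔ ∀ i, |x i| ≤ N := by
  simp only [cube, Finset.mem_Icc, Pi.le_def, ← forall_and, abs_le]

theorem zero_mem_cube {N : ℕ} : (0 : Fin d → ℤ) ∈ cube d N := mem_cube.2 fun i => by simp

theorem card_cube (d N : ℕ) : (cube d N).card = (2 * N + 1) ^ d := by
  rw [cube, Pi.card_Icc]
  simp only [Int.card_Icc, Finset.prod_const, Finset.card_univ, Fintype.card_fin]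
  congr 1
  omega

theorem exists_subset_cube (s : Finset (Fin d → ℤ)) : ∃ R, s ⊆ cube d R := by
  refine ⟨s.sup fun x => Finset.univ.sup fun i => (x i).natAbs, fun x hx => mem_cube.2 fun i => ?_⟩
  have h1 : (x i).natAbs ≤ Finset.univ.sup fun i => (x i).natAbs :=
    Finset.le_sup (f := fun i => (x i).natAbs) (Finset.mem_univ i)
  have h2 := Finset.le_sup (f := fun x : Fin d → ℤ => Finset.univ.sup fun i => (x i).natAbs) hx
  have := h1.trans h2
  rw [Int.abs_eq_natAbs]
  exact_mod_cast this

theorem add_mem_cube {M N : ℕ} {x y : Fin d → ℤ} (hx : x ∈ cube d M) (hy : y ∈ cube d N) :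
    x + y ∈ cube d (M + N) := mem_cube.2 fun i => by
  have := mem_cube.1 hx i
  have := mem_cube.1 hy i
  push_cast
  exact (abs_add_le _ _).trans (by linarith)

/-- The two points `0` and `y` both lie in large clusters with probability at least `tail ^ 2`, by
the Harris–FKG inequality; either these clusters coincide, or the pair `{0, y}` joins two distinct
large clusters, and the latter is controlled on average by the two-ghost inequality. The
inequality is summed over `y ∈ D`; it is obtained in a large cube, whose boundary is
negligible. -/
theorem card_mul_tail_sq_le (hp : ∀ e, p e ∈ Set.Icc (0 : ℝ) 1)
    (hinv : ∀ v e, p (shift v e) = p e) {D : Finset (Fin d → ℤ)} {m : ℕ} (hDm : D ⊆ cube d m)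
    (hD : ∀ y ∈ D, -y ∉ D) (hu : ∀ e, 0 ≤ u e) (hup : ∀ x, ∀ y ∈ D, 1 ≤ u s(x, x + y) * p s(x, x + y))
    {v : ℝ} (hv0 : 0 < v) (hv : ∀ F b, varAt p u F {b} ≤ v) {n : ℕ} (hn : 1 ≤ n) {X T : ℝ}
    (hX : ∀ F x, bernExp p F (fun S => (cardIn S ((cube d m).map (addLeftEmbedding x)) x : ℝ)) ≤ X)
    (hT : ∀ K, ∑ k ∈ Finset.Icc (1 : ℕ) K, 1 / (√(k : ℝ) * max (k : ℝ) n) * tail p k ≤ T) :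
    D.card * tail p n ^ 2 ≤ X + √v * T := by
  have hT0 : 0 ≤ T := by simpa using hT 0
  -- It suffices to bound the square of any probability in finite volume.
  suffices key : ∀ F₀ : Finset (Sym2 (Fin d → ℤ)),
      D.card * bernProb p F₀ (fun S => n ≤ (clus S {0}).card) ^ 2 ≤ X + √v * T by
    have hcont : Continuous fun t : ℝ => D.card * t ^ 2 := by fun_prop
    have hmem : tail p n ∈ closure (Set.range fun F : Finset (Sym2 (Fin d → ℤ)) =>
        bernProb p F (fun S => n ≤ (clus S {0}).card)) :=
      csSup_mem_closure (Set.range_nonempty _) (bddAbove_tail hp n)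
    have hcl : IsClosed {t : ℝ | D.card * t ^ 2 ≤ X + √v * T} :=
      isClosed_le hcont continuous_const
    exact closure_minimal (by rintro _ ⟨F, rfl⟩; exact key F) hcl hmem
  intro F₀
  set f := bernProb p F₀ (fun S => n ≤ (clus S {0}).card) with hf
  have hf0 : 0 ≤ f := bernProb_nonneg hp _
  obtain ⟨R, hR⟩ := exists_subset_cube (F₀.biUnion Sym2.toFinset)
  have hRe : ∀ e ∈ F₀, ∀ z ∈ e, z ∈ cube d R := fun e he z hz =>
    hR (Finset.mem_biUnion.2 ⟨e, he, Sym2.mem_toFinset.2 hz⟩)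
  have hvol : ∀ N : ℕ, (2 * (N : ℝ) + 1) ^ d * (D.card * f ^ 2) ≤
      (2 * (N : ℝ) + 1) ^ d * X + (2 * ((N + m + R : ℕ) : ℝ) + 1) ^ d * (√v * T) := by
    intro N
    set Λ := cube d (N + m + R) with hΛ
    set F := Λ.sym2 with hF
    have hFΛ : ∀ e ∈ F, ∀ z ∈ e, z ∈ Λ := fun e he z hz => Finset.mem_sym2_iff.1 he z hz
    have hpt : ∀ x ∈ cube d (N + m), f ≤ bernProb p F (fun S => n ≤ (clus S {x}).card) := by
      intro x hx
      have h1 := bernProb_map_shift hinv F₀ n x 0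
      rw [add_zero] at h1
      rw [hf, ← h1]
      refine bernProb_mono_set hp (increasing_le_card_clus _ _) fun e he => ?_
      obtain ⟨e', he', rfl⟩ := Finset.mem_map.1 he
      have := hRe e' he'
      induction e' with
      | h a b =>
        exact Finset.mk_mem_sym2_iff.2 ⟨add_mem_cube hx (this a (Sym2.mem_mk_left a b)),
          add_mem_cube hx (this b (Sym2.mem_mk_right a b))⟩
    have hmem0 : ∀ x ∈ cube d N, x ∈ cube d (N + m) := fun x hx => by
      have := add_mem_cube hx (zero_mem_cube (N := m))
      rwa [add_zero] at this
    have hmemD : ∀ x ∈ cube d N, ∀ y ∈ D, x + y ∈ cube d (N + m) := fun x hx y hy =>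
      add_mem_cube hx (hDm hy)
    have hmemR : ∀ x ∈ cube d (N + m), x ∈ Λ := fun x hx => by
      have := add_mem_cube hx (zero_mem_cube (N := R))
      rwa [add_zero] at this
    have hpair : ∀ x ∈ cube d N, ∀ y ∈ D, f ^ 2 ≤ bernProb p F (fun S => Conn S x (x + y)) +
        bernProb p F (TwoLarge n s(x, x + y)) := by
      intro x hx y hy
      rw [sq]
      refine (mul_le_mul (hpt x (hmem0 x hx)) (hpt _ (hmemD x hx y hy)) hf0
        (bernProb_nonneg hp _)).trans ?_
      refine (bernProb_mul_le_bernProb_and hp (increasing_le_card_clus _ _)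
        (increasing_le_card_clus _ _)).trans (bernProb_le_add hp ?_)
      rintro S - ⟨h1, h2⟩
      by_cases hc : Conn S x (x + y)
      · exact Or.inl hc
      · exact Or.inr ⟨x, x + y, rfl, h1, h2, hc⟩
    have hconn : ∀ x, ∑ y ∈ D, bernProb p F (fun S => Conn S x (x + y)) ≤ X := by
      intro x
      refine le_trans ?_ (hX F x)
      rw [bernExp_cardIn_eq, Finset.sum_map]
      exact Finset.sum_le_sum_of_subset_of_nonneg hDm fun y _ _ => bernProb_nonneg hp _
    have htwo : ∑ x ∈ cube d N, ∑ y ∈ D, bernProb p F (TwoLarge n s(x, x + y)) ≤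
        Λ.card * (√v * T) := by
      refine le_trans ?_ (sum_twoLarge_le_of_tail hp hu hFΛ hn hv0 (hv F)
        (fun k x => bernProb_le_tail hp hinv F k x) hT)
      rw [← Finset.sum_product']
      have hinj : Set.InjOn (fun z : (Fin d → ℤ) × (Fin d → ℤ) => s(z.1, z.1 + z.2))
          ↑(cube d N ×ˢ D) := by
        rintro ⟨x, y⟩ hxy ⟨x', y'⟩ hxy' h
        simp only [Finset.coe_product, Set.mem_prod, Finset.mem_coe] at hxy hxy'
        rcases Sym2.eq_iff.1 h with ⟨h1, h2⟩ | ⟨h1, h2⟩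
        · subst h1
          simpa using h2
        · refine (hD y hxy.2 ?_).elim
          have : y' = -y := by
            rw [h1] at h2
            have := eq_neg_of_add_eq_zero_right (a := y) (b := y') (by
              have h3 : x' + (y' + y) = x' + 0 := by rw [← add_assoc, h2, add_zero]
              rw [add_comm]
              exact add_left_cancel h3)
            exact this
          rw [← this]
          exact hxy'.2
      have hle : ∀ z ∈ cube d N ×ˢ D, bernProb p F (TwoLarge n s(z.1, z.1 + z.2)) ≤
          u s(z.1, z.1 + z.2) * p s(z.1, z.1 + z.2) *
            bernProb p F (TwoLarge n s(z.1, z.1 + z.2)) := fun z hz =>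
        le_mul_of_one_le_left (bernProb_nonneg hp _) (hup z.1 z.2 (Finset.mem_product.1 hz).2)
      refine (Finset.sum_le_sum hle).trans ?_
      rw [← Finset.sum_image (f := fun e => u e * p e * bernProb p F (TwoLarge n e)) hinj]
      refine Finset.sum_le_sum_of_subset_of_nonneg ?_ fun e _ _ =>
        mul_nonneg (mul_nonneg (hu e) (hp e).1) (bernProb_nonneg hp _)
      intro e he
      obtain ⟨z, hz, rfl⟩ := Finset.mem_image.1 he
      obtain ⟨hz1, hz2⟩ := Finset.mem_product.1 hz
      exact Finset.mk_mem_sym2_iff.2 ⟨hmemR _ (hmem0 _ hz1), hmemR _ (hmemD _ hz1 _ hz2)⟩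
    have hsum : ∑ _x ∈ cube d N, ∑ _y ∈ D, f ^ 2 ≤ ∑ x ∈ cube d N, ∑ y ∈ D,
        (bernProb p F (fun S => Conn S x (x + y)) + bernProb p F (TwoLarge n s(x, x + y))) :=
      Finset.sum_le_sum fun x hx => Finset.sum_le_sum fun y hy => hpair x hx y hy
    simp only [Finset.sum_add_distrib] at hsum
    have hX' : ∑ x ∈ cube d N, ∑ y ∈ D, bernProb p F (fun S => Conn S x (x + y)) ≤
        (cube d N).card * X := by
      rw [← nsmul_eq_mul]
      exact Finset.sum_le_card_nsmul _ _ _ fun x _ => hconn x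
    have hcube : ((cube d N).card : ℝ) = (2 * (N : ℝ) + 1) ^ d := by
      rw [card_cube]; push_cast; rfl
    have hcubeΛ : (Λ.card : ℝ) = (2 * ((N + m + R : ℕ) : ℝ) + 1) ^ d := by
      rw [hΛ, card_cube]; push_cast; rfl
    simp only [Finset.sum_const, nsmul_eq_mul] at hsum
    rw [hcube] at hX' hsum
    rw [hcubeΛ] at htwo
    linarith
  have hlim : Filter.Tendsto (fun N : ℕ => X + (1 + (2 * ((m + R : ℕ) : ℝ)) / (2 * (N : ℝ) + 1)) ^ d *
      (√v * T)) Filter.atTop (nhds (X + (1 + 0) ^ d * (√v * T))) := by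
    refine Filter.Tendsto.const_add _ (Filter.Tendsto.mul_const _
      (Filter.Tendsto.pow (Filter.Tendsto.const_add _ ?_) d))
    refine Filter.Tendsto.const_div_atTop ?_ _
    exact Filter.tendsto_atTop_add_const_right _ _
      (tendsto_natCast_atTop_atTop.const_mul_atTop (by norm_num))
  rw [add_zero, one_pow, one_mul] at hlim
  refine ge_of_tendsto' hlim fun N => ?_
  have hN : (0 : ℝ) < 2 * (N : ℝ) + 1 := by positivity
  have hNd : (0 : ℝ) < (2 * (N : ℝ) + 1) ^ d := by positivity
  have h := hvol N
  have e : (2 * ((N + m + R : ℕ) : ℝ) + 1) ^ d =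
      (2 * (N : ℝ) + 1) ^ d * (1 + (2 * ((m + R : ℕ) : ℝ)) / (2 * (N : ℝ) + 1)) ^ d := by
    rw [← mul_pow]
    congr 1
    push_cast
    field_simp
    ring
  rw [e, mul_assoc, ← mul_add] at h
  exact le_of_mul_le_mul_left h hNd

end Lattice

/-! ### Power sums -/

theorem sum_rpow_neg_le {s : ℝ} (hs0 : 0 ≤ s) (hs1 : s < 1) (K : ℕ) :
    ∑ k ∈ Finset.Icc (1 : ℕ) K, (k : ℝ) ^ (-s) ≤ (K : ℝ) ^ (1 - s) / (1 - s) := by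
  have h1s : 0 < 1 - s := by linarith
  induction K with
  | zero => simp [Real.zero_rpow h1s.ne']
  | succ K ih =>
    rw [Finset.sum_Icc_succ_top (by omega)]
    set y : ℝ := ((K + 1 : ℕ) : ℝ) with hy
    have hyK : (K : ℝ) = y * (1 + -(1 / y)) := by
      have : y ≠ 0 := by positivity
      field_simp
      rw [hy]; push_cast; ring
    have hy1 : 1 ≤ y := by rw [hy]; push_cast; linarith [Nat.cast_nonneg (α := ℝ) K]
    have hy0 : 0 < y := by linarith
    have hinv : 1 / y ≤ 1 := by rw [div_le_one hy0]; exact hy1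
    have h2 : (K : ℝ) ^ (1 - s) ≤ y ^ (1 - s) - (1 - s) * y ^ (-s) := by
      have h3 := rpow_one_add_le_one_add_mul_self (s := -(1 / y)) (by linarith) h1s.le (by linarith)
      rw [hyK, Real.mul_rpow hy0.le (by linarith)]
      refine (mul_le_mul_of_nonneg_left h3 (by positivity)).trans (le_of_eq ?_)
      have : y ^ (1 - s) = y * y ^ (-s) := by
        rw [sub_eq_add_neg, Real.rpow_add hy0, Real.rpow_one]
      rw [this]
      field_simp
      ring
    rw [le_div_iff₀ h1s] at ih ⊢
    rw [add_mul]
    linarith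

theorem sum_rpow_tail_le {s : ℝ} (hs0 : 0 < s) {n : ℕ} (hn : 1 ≤ n) (K : ℕ) :
    ∑ k ∈ Finset.Ioc n K, (k : ℝ) ^ (-1 - s) ≤ (n : ℝ) ^ (-s) / s := by
  rcases le_or_gt K n with hK | hK
  · rw [Finset.Ioc_eq_empty (by omega), Finset.sum_empty]
    positivity
  suffices h : ∑ k ∈ Finset.Ioc n K, (k : ℝ) ^ (-1 - s) ≤
      ((n : ℝ) ^ (-s) - (K : ℝ) ^ (-s)) / s by
    refine h.trans (div_le_div_of_nonneg_right ?_ hs0.le)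
    linarith [Real.rpow_nonneg (Nat.cast_nonneg (α := ℝ) K) (-s)]
  induction K, hK.le using Nat.le_induction with
  | base => simp
  | succ K hKn ih =>
    have ih' : ∑ k ∈ Finset.Ioc n K, (k : ℝ) ^ (-1 - s) ≤
        ((n : ℝ) ^ (-s) - (K : ℝ) ^ (-s)) / s := by
      rcases eq_or_lt_of_le hKn with h | h
      · subst h; simp
      · exact ih h
    rw [← Finset.insert_Ioc_right_eq_Ioc_add_one hKn, Finset.sum_insert (by simp)]
    set y : ℝ := ((K + 1 : ℕ) : ℝ) with hy
    have hK1 : (1 : ℝ) ≤ K := by exact_mod_cast hn.trans hKn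
    have hyK' : y = K + 1 := by rw [hy]; push_cast; ring
    have hy0 : 0 < y := by linarith
    have hyK : (K : ℝ) = y * (1 - 1 / y) := by
      field_simp
      linarith
    have hpos : 0 < 1 - 1 / y := by
      rw [sub_pos, div_lt_one hy0]; linarith
    have h2 : y ^ (-s) + s * y ^ (-1 - s) ≤ (K : ℝ) ^ (-s) := by
      have h3 : 1 + s / y ≤ (1 - 1 / y) ^ (-s) := by
        have h4 : (1 - 1 / y) ^ s ≤ Real.exp (-(s / y)) := by
          have h5 : 1 - 1 / y ≤ Real.exp (-(1 / y)) := by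
            have := Real.add_one_le_exp (-(1 / y)); linarith
          refine (Real.rpow_le_rpow hpos.le h5 hs0.le).trans (le_of_eq ?_)
          rw [← Real.exp_mul]
          congr 1
          ring
        rw [Real.rpow_neg hpos.le]
        have h6 : 1 + s / y ≤ Real.exp (s / y) := by
          have := Real.add_one_le_exp (s / y); linarith
        refine h6.trans ?_
        rw [← inv_inv (Real.exp (s / y)), ← Real.exp_neg]
        exact inv_anti₀ (Real.rpow_pos_of_pos hpos s) h4
      rw [hyK, Real.mul_rpow hy0.le hpos.le]
      refine le_trans (le_of_eq ?_) (mul_le_mul_of_nonneg_left h3 (by positivity))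
      have : y ^ (-1 - s) = y⁻¹ * y ^ (-s) := by
        rw [sub_eq_add_neg, Real.rpow_add hy0, Real.rpow_neg_one]
      rw [this]
      field_simp
    rw [le_div_iff₀ hs0] at ih' ⊢
    rw [add_mul]
    linarith

/-- The sum controlling the fluctuations in the two-ghost inequality, for a power-law tail. -/
theorem sum_weight_mul_tail_le {θ A : ℝ} (hθ0 : 0 < θ) (hθ : θ < 1 / 2) (hA : 0 ≤ A) {t : ℕ → ℝ}
    (ht0 : ∀ k, 0 ≤ t k) (ht : ∀ k : ℕ, 1 ≤ k → t k ≤ A * (k : ℝ) ^ (-θ)) {n : ℕ} (hn : 1 ≤ n)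
    (K : ℕ) : ∑ k ∈ Finset.Icc (1 : ℕ) K, 1 / (√(k : ℝ) * max (k : ℝ) n) * t k ≤
      (1 / (1 / 2 - θ) + 1 / (1 / 2 + θ)) * A * (n : ℝ) ^ (-(1 / 2) - θ) := by
  have hn0 : (0 : ℝ) < n := by exact_mod_cast hn
  have hsqrt : ∀ k : ℕ, 1 ≤ k → 1 / √(k : ℝ) * t k ≤ A * (k : ℝ) ^ (-(1 / 2 + θ)) := by
    intro k hk
    have hk0 : (0 : ℝ) < k := by exact_mod_cast hk
    have h1 : (k : ℝ) ^ (-(1 / 2 + θ)) = 1 / √(k : ℝ) * (k : ℝ) ^ (-θ) := by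
      rw [neg_add, Real.rpow_add hk0, Real.rpow_neg hk0.le (1 / 2), Real.sqrt_eq_rpow,
        one_div ((k : ℝ) ^ (1 / 2 : ℝ))]
    rw [h1]
    have := mul_le_mul_of_nonneg_left (ht k hk) (show 0 ≤ 1 / √(k : ℝ) by positivity)
    linarith
  have hterm : ∀ k : ℕ, 1 / (√(k : ℝ) * max (k : ℝ) n) * t k =
      (1 / √(k : ℝ) * t k) / max (k : ℝ) n := fun k => by
    rw [← div_div]; ring
  have hmaxpos : ∀ k : ℕ, 0 < max (k : ℝ) n := fun k => lt_max_of_lt_right hn0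
  have hnn : ∀ k : ℕ, 0 ≤ 1 / (√(k : ℝ) * max (k : ℝ) n) * t k := fun k =>
    mul_nonneg (one_div_nonneg.2 (mul_nonneg (Real.sqrt_nonneg _) (hmaxpos k).le)) (ht0 k)
  have hsplit : ∑ k ∈ Finset.Icc (1 : ℕ) K, 1 / (√(k : ℝ) * max (k : ℝ) n) * t k ≤
      ∑ k ∈ Finset.Icc (1 : ℕ) n, 1 / (√(k : ℝ) * max (k : ℝ) n) * t k +
        ∑ k ∈ Finset.Ioc n K, 1 / (√(k : ℝ) * max (k : ℝ) n) * t k := by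
    rw [← Finset.sum_union (Finset.disjoint_left.2 fun k h1 h2 => by
      simp only [Finset.mem_Icc, Finset.mem_Ioc] at h1 h2; omega)]
    refine Finset.sum_le_sum_of_subset_of_nonneg (fun k hk => ?_) fun k _ _ => hnn k
    simp only [Finset.mem_union, Finset.mem_Icc, Finset.mem_Ioc] at hk ⊢
    omega
  have h1 : ∑ k ∈ Finset.Icc (1 : ℕ) n, 1 / (√(k : ℝ) * max (k : ℝ) n) * t k ≤
      A / n * ((n : ℝ) ^ (1 - (1 / 2 + θ)) / (1 - (1 / 2 + θ))) := by
    refine le_trans ?_ (mul_le_mul_of_nonneg_left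
      (sum_rpow_neg_le (s := 1 / 2 + θ) (by linarith) (by linarith) n) (by positivity))
    rw [Finset.mul_sum]
    refine Finset.sum_le_sum fun k hk => ?_
    obtain ⟨hk1, hkn⟩ := Finset.mem_Icc.1 hk
    have : (k : ℝ) ≤ n := by exact_mod_cast hkn
    rw [hterm, max_eq_right this, div_mul_eq_mul_div A]
    exact div_le_div_of_nonneg_right (hsqrt k hk1) hn0.le
  have h2 : ∑ k ∈ Finset.Ioc n K, 1 / (√(k : ℝ) * max (k : ℝ) n) * t k ≤
      A * ((n : ℝ) ^ (-(1 / 2 + θ)) / (1 / 2 + θ)) := by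
    refine le_trans ?_ (mul_le_mul_of_nonneg_left
      (sum_rpow_tail_le (s := 1 / 2 + θ) (by linarith) hn K) hA)
    rw [Finset.mul_sum]
    refine Finset.sum_le_sum fun k hk => ?_
    obtain ⟨hk1, hkn⟩ := Finset.mem_Ioc.1 hk
    have hk0 : (0 : ℝ) < k := by exact_mod_cast (by omega : 0 < k)
    have : (n : ℝ) ≤ k := by exact_mod_cast hk1.le
    rw [hterm, max_eq_left this, sub_eq_add_neg, Real.rpow_add hk0, Real.rpow_neg_one, div_le_iff₀ hk0]
    refine (hsqrt k (by omega)).trans (le_of_eq ?_)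
    field_simp
  have e1 : A / n * ((n : ℝ) ^ (1 - (1 / 2 + θ)) / (1 - (1 / 2 + θ))) =
      1 / (1 / 2 - θ) * A * (n : ℝ) ^ (-(1 / 2) - θ) := by
    have h3 : (n : ℝ) ^ (1 - (1 / 2 + θ)) = n * (n : ℝ) ^ (-(1 / 2) - θ) := by
      rw [show 1 - (1 / 2 + θ) = 1 + (-(1 / 2) - θ) by ring, Real.rpow_add hn0, Real.rpow_one]
    rw [h3, show 1 - (1 / 2 + θ) = 1 / 2 - θ by ring]
    field_simp
  have e2 : A * ((n : ℝ) ^ (-(1 / 2 + θ)) / (1 / 2 + θ)) =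
      1 / (1 / 2 + θ) * A * (n : ℝ) ^ (-(1 / 2) - θ) := by
    rw [show -(1 / 2 + θ) = -(1 / 2) - θ by ring]
    ring
  rw [e1] at h1
  rw [e2] at h2
  linarith

/-! ### Expected size of a cluster inside a finite set -/

/-- With a power-law tail of exponent `θ`, the largest cluster in `B` is of order
`(A |B|) ^ (1 / (1 + θ))`, and sizes up to this order carry the expectation. -/
theorem bernExp_cardIn_le_of_tail {V : Type*} [DecidableEq V] {p : Sym2 V → ℝ}
    (hp : ∀ e, p e ∈ Set.Icc (0 : ℝ) 1) {F : Finset (Sym2 V)} {B : Finset V} (hB : 1 ≤ B.card)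
    (u : V) {t : ℕ → ℝ} (ht : ∀ k v, bernProb p F (fun S => k ≤ (clus S {v}).card) ≤ t k)
    {θ A : ℝ} (hθ0 : 0 < θ) (hθ : θ < 1) (hA : 1 ≤ A)
    (htA : ∀ k : ℕ, 1 ≤ k → t k ≤ A * (k : ℝ) ^ (-θ)) :
    bernExp p F (fun S => (cardIn S B u : ℝ)) ≤
      96 / (1 - θ) * A ^ (2 / (1 + θ)) * (B.card : ℝ) ^ ((1 - θ) / (1 + θ)) := by
  have hb : (1 : ℝ) ≤ B.card := by exact_mod_cast hB
  set b : ℝ := (B.card : ℝ) with hbdef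
  have h1θ : 0 < 1 - θ := by linarith
  set Y : ℝ := (4 * A * b) ^ (1 / (1 + θ)) with hY
  have hAb : 1 ≤ A * b := one_le_mul_of_one_le_of_one_le hA hb
  have hY1 : 1 ≤ Y := Real.one_le_rpow (by nlinarith) (by positivity)
  set M := ⌈Y⌉₊ with hM
  have hMY : Y ≤ M := Nat.le_ceil Y
  have hM1 : 1 ≤ M := by
    have : (1 : ℝ) ≤ M := hY1.trans hMY
    exact_mod_cast this
  have hM2 : (M : ℝ) ≤ 2 * Y := by
    have := Nat.ceil_lt_add_one (zero_le_one.trans hY1)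
    linarith
  have htM : ∀ l, M ≤ l → 4 * (b * t l) ≤ l := by
    intro l hl
    have hl1 : 1 ≤ l := hM1.trans hl
    have hl0 : (0 : ℝ) < l := by exact_mod_cast hl1
    have hYl : Y ≤ l := hMY.trans (by exact_mod_cast hl)
    have h1 : 4 * A * b ≤ (l : ℝ) ^ (1 + θ) := by
      have := Real.rpow_le_rpow (by linarith) hYl (show 0 ≤ 1 + θ by linarith)
      rwa [hY, ← Real.rpow_mul (by positivity), one_div_mul_cancel (by linarith), Real.rpow_one]
        at this
    have h2 : b * t l ≤ b * (A * (l : ℝ) ^ (-θ)) :=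
      mul_le_mul_of_nonneg_left (htA l hl1) (by linarith)
    have h3 := mul_le_mul_of_nonneg_right h1 (Real.rpow_nonneg hl0.le (-θ))
    rw [← Real.rpow_add hl0, add_neg_cancel_right, Real.rpow_one] at h3
    linarith
  refine (bernExp_cardIn_le hp B u ht hM1 htM).trans ?_
  have h1 : ∑ k ∈ Finset.Icc 1 (3 * M), t k ≤
      A * (((3 * M : ℕ) : ℝ) ^ (1 - θ) / (1 - θ)) := by
    refine le_trans ?_ (mul_le_mul_of_nonneg_left (sum_rpow_neg_le hθ0.le hθ (3 * M)) (by linarith))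
    rw [Finset.mul_sum]
    exact Finset.sum_le_sum fun k hk => htA k (Finset.mem_Icc.1 hk).1
  have h2 : ((3 * M : ℕ) : ℝ) ^ (1 - θ) ≤ 24 * (A * b) ^ ((1 - θ) / (1 + θ)) := by
    have h3 : ((3 * M : ℕ) : ℝ) ≤ 6 * Y := by push_cast; linarith
    refine (Real.rpow_le_rpow (Nat.cast_nonneg _) h3 h1θ.le).trans ?_
    rw [Real.mul_rpow (by norm_num) (by linarith), hY, ← Real.rpow_mul (by positivity),
      one_div_mul_eq_div, mul_assoc 4, Real.mul_rpow (by norm_num) (by linarith)]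
    have h4 : (6 : ℝ) ^ (1 - θ) ≤ 6 := by
      conv_rhs => rw [← Real.rpow_one 6]
      exact Real.rpow_le_rpow_of_exponent_le (by norm_num) (by linarith)
    have h5 : (4 : ℝ) ^ ((1 - θ) / (1 + θ)) ≤ 4 := by
      conv_rhs => rw [← Real.rpow_one 4]
      refine Real.rpow_le_rpow_of_exponent_le (by norm_num) ?_
      rw [div_le_one (by linarith)]; linarith
    have h6 : 0 ≤ (A * b) ^ ((1 - θ) / (1 + θ)) := Real.rpow_nonneg (by linarith) _
    have h7 : (6 : ℝ) ^ (1 - θ) * (4 : ℝ) ^ ((1 - θ) / (1 + θ)) ≤ 6 * 4 :=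
      mul_le_mul h4 h5 (by positivity) (by norm_num)
    calc _ = ((6 : ℝ) ^ (1 - θ) * (4 : ℝ) ^ ((1 - θ) / (1 + θ))) *
          (A * b) ^ ((1 - θ) / (1 + θ)) := by ring
      _ ≤ 6 * 4 * (A * b) ^ ((1 - θ) / (1 + θ)) := mul_le_mul_of_nonneg_right h7 h6
      _ = _ := by ring
  have h8 : A ^ (2 / (1 + θ)) = A * A ^ ((1 - θ) / (1 + θ)) := by
    rw [show 2 / (1 + θ) = 1 + (1 - θ) / (1 + θ) by field_simp; ring,
      Real.rpow_add (by linarith), Real.rpow_one]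
  calc 4 * ∑ k ∈ Finset.Icc 1 (3 * M), t k
      ≤ 4 * (A * (24 * (A * b) ^ ((1 - θ) / (1 + θ)) / (1 - θ))) := by
        refine mul_le_mul_of_nonneg_left (h1.trans ?_) (by norm_num)
        exact mul_le_mul_of_nonneg_left (div_le_div_of_nonneg_right h2 h1θ.le) (by linarith)
    _ = _ := by
        rw [h8, Real.mul_rpow (by linarith) (by linarith)]
        ring

/-! ### Bootstrapping a power-law tail -/

section Bootstrap

variable {d : ℕ} {p : Sym2 (Fin d → ℤ) → ℝ}

/-- The cube `[m, 2m]^d`. Its points have norm of order `m`, and it does not meet its negative. -/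
noncomputable def orthantCube (d m : ℕ) : Finset (Fin d → ℤ) :=
  Finset.Icc (fun _ => (m : ℤ)) (fun _ => 2 * (m : ℤ))

theorem mem_orthantCube {m : ℕ} {x : Fin d → ℤ} :
    x ∈ orthantCube d m ↔ ∀ i, (m : ℤ) ≤ x i ∧ x i ≤ 2 * m := by
  simp only [orthantCube, Finset.mem_Icc, Pi.le_def, ← forall_and]

theorem card_orthantCube (d m : ℕ) : (orthantCube d m).card = (m + 1) ^ d := by
  rw [orthantCube, Pi.card_Icc]
  simp only [Int.card_Icc, Finset.prod_const, Finset.card_univ, Fintype.card_fin]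
  congr 1
  omega

theorem orthantCube_subset_cube (d m : ℕ) : orthantCube d m ⊆ cube d (2 * m) := fun x hx =>
  mem_cube.2 fun i => by
    have := mem_orthantCube.1 hx i
    rw [abs_le]
    push_cast
    omega

theorem neg_notMem_orthantCube (hd : 1 ≤ d) {m : ℕ} (hm : 1 ≤ m) {y : Fin d → ℤ}
    (hy : y ∈ orthantCube d m) : -y ∉ orthantCube d m := fun h => by
  have h1 := mem_orthantCube.1 hy ⟨0, hd⟩
  have h2 := mem_orthantCube.1 h ⟨0, hd⟩
  rw [Pi.neg_apply] at h2
  omega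

open Classical in
/-- Weights on edges which compensate the edge probability on edges with displacement in `D`, and
vanish elsewhere. -/
noncomputable def edgeWeight (p : Sym2 (Fin d → ℤ) → ℝ) (D : Finset (Fin d → ℤ))
    (e : Sym2 (Fin d → ℤ)) : ℝ :=
  if ∃ x, ∃ y ∈ D, e = s(x, x + y) then 1 / p e else 0

theorem edgeWeight_nonneg (hp : ∀ e, p e ∈ Set.Icc (0 : ℝ) 1) (D : Finset (Fin d → ℤ))
    (e : Sym2 (Fin d → ℤ)) : 0 ≤ edgeWeight p D e := by
  unfold edgeWeight
  split_ifs
  · exact one_div_nonneg.2 (hp e).1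
  · exact le_rfl

theorem varAt_edgeWeight_le (hp : ∀ e, p e ∈ Set.Icc (0 : ℝ) 1) {D : Finset (Fin d → ℤ)} {η : ℝ}
    (hη : 0 < η) (hlow : ∀ x, ∀ y ∈ D, η ≤ p s(x, x + y)) (F : Finset (Sym2 (Fin d → ℤ)))
    (b : Fin d → ℤ) : varAt p (edgeWeight p D) F {b} ≤ 2 * D.card / η := by
  classical
  set I := D.image (fun y => s(b, b + y)) ∪ D.image (fun y => s(b - y, b)) with hI
  have hterm : ∀ e, edgeWeight p D e ^ 2 * (p e * (1 - p e)) ≤ 1 / η := by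
    intro e
    unfold edgeWeight
    split_ifs with h
    · obtain ⟨x, y, hy, rfl⟩ := h
      have h1 := hlow x y hy
      have h2 : 0 < p s(x, x + y) := hη.trans_le h1
      have h3 : (1 / p s(x, x + y)) ^ 2 * (p s(x, x + y) * (1 - p s(x, x + y))) =
          (1 - p s(x, x + y)) / p s(x, x + y) := by field_simp
      rw [h3]
      exact div_le_div₀ zero_le_one (by linarith) hη h1
    · have := hη.le
      rw [zero_pow (by norm_num), zero_mul]
      positivity
  have hsub : varAt p (edgeWeight p D) F {b} ≤
      ∑ e ∈ I, edgeWeight p D e ^ 2 * (p e * (1 - p e)) := by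
    unfold varAt
    rw [← Finset.sum_filter_add_sum_filter_not _ (fun e => ∃ x, ∃ y ∈ D, e = s(x, x + y))]
    have h0 : ∑ e ∈ (F.filter fun e => Touches e {b}).filter
        (fun e => ¬ ∃ x, ∃ y ∈ D, e = s(x, x + y)),
          edgeWeight p D e ^ 2 * (p e * (1 - p e)) = 0 :=
      Finset.sum_eq_zero fun e he => by
        rw [edgeWeight, if_neg (Finset.mem_filter.1 he).2]; ring
    rw [h0, add_zero]
    refine Finset.sum_le_sum_of_subset_of_nonneg ?_ fun e _ _ => varAt_term_nonneg hp e
    intro e he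
    obtain ⟨he1, x, y, hy, rfl⟩ := Finset.mem_filter.1 he
    obtain ⟨-, w, hw, hwe⟩ := Finset.mem_filter.1 he1
    obtain rfl := Finset.mem_singleton.1 hw
    rw [hI, Finset.mem_union, Finset.mem_image, Finset.mem_image]
    rcases Sym2.mem_iff.1 hwe with rfl | rfl
    · exact Or.inl ⟨y, hy, rfl⟩
    · exact Or.inr ⟨y, hy, by rw [add_sub_cancel_right]⟩
  have hcard : (I.card : ℝ) ≤ 2 * D.card := by
    have h1 := Finset.card_union_le (D.image (fun y => s(b, b + y))) (D.image (fun y => s(b - y, b)))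
    have h2 : (D.image (fun y => s(b, b + y))).card ≤ D.card := Finset.card_image_le
    have h3 : (D.image (fun y => s(b - y, b))).card ≤ D.card := Finset.card_image_le
    exact_mod_cast (by rw [hI]; omega : I.card ≤ 2 * D.card)
  refine hsub.trans ((Finset.sum_le_card_nsmul _ _ _ fun e _ => hterm e).trans ?_)
  rw [nsmul_eq_mul, mul_one_div]
  exact div_le_div_of_nonneg_right hcard hη.le

/-- The basic inequality at scale `m`: two points at distance of order `m` lie in a common
cluster, or in distinct large clusters. -/
theorem tail_sq_le (hd : 1 ≤ d) (hp : ∀ e, p e ∈ Set.Icc (0 : ℝ) 1)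
    (hinv : ∀ v e, p (shift v e) = p e) {α κ θ A : ℝ} (hκ : 0 < κ) {m : ℕ} (hm : 1 ≤ m)
    (hlow : ∀ x, ∀ y ∈ orthantCube d m, κ * (m : ℝ) ^ (-(d : ℝ) - α) ≤ p s(x, x + y))
    (hθ0 : 0 < θ) (hθ : θ < 1 / 2) (hA : 1 ≤ A)
    (htail : ∀ k : ℕ, 1 ≤ k → tail p k ≤ A * (k : ℝ) ^ (-θ)) {n : ℕ} (hn : 1 ≤ n) :
    tail p n ^ 2 ≤ 96 / (1 - θ) * 4 ^ d * A ^ (2 / (1 + θ)) * (m : ℝ) ^ (-(2 * d * θ / (1 + θ))) +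
      √(2 / κ) * (1 / (1 / 2 - θ) + 1 / (1 / 2 + θ)) * A * (m : ℝ) ^ (α / 2) *
        (n : ℝ) ^ (-(1 / 2) - θ) := by
  have hm0 : (0 : ℝ) < m := by exact_mod_cast hm
  set D := orthantCube d m with hD
  have hDc : (D.card : ℝ) = ((m : ℝ) + 1) ^ d := by rw [hD, card_orthantCube]; push_cast; rfl
  have hDpos : (0 : ℝ) < D.card := by rw [hDc]; positivity
  have hDm : (m : ℝ) ^ (d : ℝ) ≤ D.card := by
    rw [hDc, Real.rpow_natCast]; exact pow_le_pow_left₀ hm0.le (by linarith) d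
  have hmα : 0 < (m : ℝ) ^ α := Real.rpow_pos_of_pos hm0 α
  set η := κ * (m : ℝ) ^ (-(d : ℝ) - α) with hη
  have hη0 : 0 < η := mul_pos hκ (Real.rpow_pos_of_pos hm0 _)
  set v : ℝ := 2 / κ * (m : ℝ) ^ α * (D.card : ℝ) ^ 2 with hv
  have hv0 : 0 < v := by positivity
  have hvar : ∀ F b, varAt p (edgeWeight p D) F {b} ≤ v := fun F b => by
    refine (varAt_edgeWeight_le hp hη0 hlow F b).trans ?_
    have h1 : 1 / η = 1 / κ * ((m : ℝ) ^ (d : ℝ) * (m : ℝ) ^ α) := by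
      rw [hη, show -(d : ℝ) - α = -((d : ℝ) + α) by ring, Real.rpow_neg hm0.le,
        Real.rpow_add hm0]
      field_simp
    rw [← mul_one_div, h1, hv]
    have h2 := mul_le_mul_of_nonneg_left hDm
      (show 0 ≤ 2 * (D.card : ℝ) * (1 / κ) * (m : ℝ) ^ α by positivity)
    calc _ = 2 * (D.card : ℝ) * (1 / κ) * (m : ℝ) ^ α * (m : ℝ) ^ (d : ℝ) := by ring
      _ ≤ _ := h2
      _ = _ := by ring
  have hup : ∀ x, ∀ y ∈ D, 1 ≤ edgeWeight p D s(x, x + y) * p s(x, x + y) := fun x y hy => by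
    rw [edgeWeight, if_pos ⟨x, y, hy, rfl⟩, one_div_mul_cancel (hη0.trans_le (hlow x y hy)).ne']
  set b : ℝ := ((cube d (2 * m)).card : ℝ) with hb
  have hb' : b = (4 * (m : ℝ) + 1) ^ d := by rw [hb, card_cube]; push_cast; ring
  have hb1 : 1 ≤ (cube d (2 * m)).card := Finset.card_pos.2 ⟨0, zero_mem_cube⟩
  have hX : ∀ F x, bernExp p F (fun S =>
      (cardIn S ((cube d (2 * m)).map (addLeftEmbedding x)) x : ℝ)) ≤
        96 / (1 - θ) * A ^ (2 / (1 + θ)) * b ^ ((1 - θ) / (1 + θ)) := fun F x => by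
    have := bernExp_cardIn_le_of_tail hp (F := F) (B := (cube d (2 * m)).map (addLeftEmbedding x))
      (by rwa [Finset.card_map]) x (fun k v => bernProb_le_tail hp hinv F k v) hθ0 (by linarith) hA
      htail
    rwa [Finset.card_map] at this
  have hT := sum_weight_mul_tail_le hθ0 hθ (by linarith) (tail_nonneg hp) htail hn
  have main := card_mul_tail_sq_le hp hinv (orthantCube_subset_cube d m)
    (fun y hy => neg_notMem_orthantCube hd hm hy) (edgeWeight_nonneg hp D) hup hv0 hvar hn hX hT
  have hbpow : b ^ ((1 - θ) / (1 + θ)) ≤ D.card * (4 ^ d * (m : ℝ) ^ (-(2 * d * θ / (1 + θ)))) := by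
    have hbpos : 0 < b := by rw [hb']; positivity
    have h1 : b ^ ((1 - θ) / (1 + θ)) = b * b ^ (-(2 * θ / (1 + θ))) := by
      rw [show (1 - θ) / (1 + θ) = 1 + -(2 * θ / (1 + θ)) by field_simp; ring,
        Real.rpow_add hbpos, Real.rpow_one]
    have h2 : b ≤ D.card * 4 ^ d := by
      rw [hb', hDc, ← mul_pow]
      exact pow_le_pow_left₀ (by positivity) (by linarith) d
    have h3 : b ^ (-(2 * θ / (1 + θ))) ≤ (m : ℝ) ^ (-(2 * d * θ / (1 + θ))) := by
      have h4 : (m : ℝ) ^ (d : ℝ) ≤ b := by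
        rw [hb', Real.rpow_natCast]; exact pow_le_pow_left₀ hm0.le (by linarith) d
      refine (Real.rpow_le_rpow_of_nonpos (Real.rpow_pos_of_pos hm0 _) h4 ?_).trans (le_of_eq ?_)
      · rw [neg_nonpos]; positivity
      · rw [← Real.rpow_mul hm0.le]; congr 1; ring
    rw [h1, ← mul_assoc]
    exact mul_le_mul h2 h3 (Real.rpow_nonneg hbpos.le _) (by positivity)
  have hsv : √v = √(2 / κ) * (m : ℝ) ^ (α / 2) * D.card := by
    rw [hv, Real.sqrt_mul (by positivity), Real.sqrt_mul (by positivity), Real.sqrt_sq hDpos.le,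
      Real.sqrt_eq_rpow ((m : ℝ) ^ α), ← Real.rpow_mul hm0.le, mul_one_div]
  have hX' := mul_le_mul_of_nonneg_left hbpow
    (show 0 ≤ 96 / (1 - θ) * A ^ (2 / (1 + θ)) by
      have : 0 < 1 - θ := by linarith
      positivity)
  rw [hsv] at main
  refine le_of_mul_le_mul_left (main.trans (le_trans (add_le_add_left hX' _) (le_of_eq ?_))) hDpos
  ring

/-- An a priori power-law bound with exponent `θ = (d - α) / (2 d + α)` and any constant improves
to one with a constant depending only on the lower bound for the edge probabilities: by
`tail_sq_le` with `m` of order `n ^ ((1 + θ) / d)`, the best constant `A`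
satisfies `A ^ 2 ≤ C * A ^ (2 / (1 + θ))`. -/
theorem exists_uniform_tail_bound (hd : 1 ≤ d) {α κ : ℝ} (hα0 : 0 < α) (hαd : α < d) (hκ : 0 < κ)
    (m₀ : ℕ) {θ : ℝ} (hθdef : θ = ((d : ℝ) - α) / (2 * d + α)) :
    ∃ C : ℝ, 1 ≤ C ∧ ∀ p : Sym2 (Fin d → ℤ) → ℝ, (∀ e, p e ∈ Set.Icc (0 : ℝ) 1) →
      (∀ v e, p (shift v e) = p e) →
      (∀ m : ℕ, 1 ≤ m → m₀ ≤ m → ∀ x, ∀ y ∈ orthantCube d m,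
        κ * (m : ℝ) ^ (-(d : ℝ) - α) ≤ p s(x, x + y)) →
      (∃ A₀ : ℝ, ∀ k : ℕ, 1 ≤ k → tail p k ≤ A₀ * (k : ℝ) ^ (-θ)) →
      ∀ k : ℕ, 1 ≤ k → tail p k ≤ C * (k : ℝ) ^ (-θ) := by
  have hd0 : (0 : ℝ) < d := by exact_mod_cast hd
  have hden : 0 < 2 * (d : ℝ) + α := by linarith
  have hθ0 : 0 < θ := by rw [hθdef]; exact div_pos (by linarith) hden
  have hθ : θ < 1 / 2 := by
    rw [hθdef, div_lt_div_iff₀ hden (by norm_num)]; linarith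
  have h1θ : 0 < 1 + θ := by linarith
  set C₁ : ℝ := 96 / (1 - θ) * 4 ^ d with hC₁
  set C₂ : ℝ := √(2 / κ) * (1 / (1 / 2 - θ) + 1 / (1 / 2 + θ)) with hC₂
  have hC₁0 : 0 ≤ C₁ := by
    have : 0 < 1 - θ := by linarith
    positivity
  have hC₂0 : 0 ≤ C₂ := by
    have : 0 < 1 / 2 - θ := by linarith
    positivity
  set n₁ : ℝ := (m₀ : ℝ) ^ ((d : ℝ) / (1 + θ)) with hn₁
  have hn₁0 : 0 ≤ n₁ := Real.rpow_nonneg (Nat.cast_nonneg _) _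
  set C₃ : ℝ := C₁ + C₂ * 2 ^ (α / 2) + n₁ ^ (2 * θ) + 1 with hC₃
  have hC₃1 : 1 ≤ C₃ := by
    have : 0 ≤ n₁ ^ (2 * θ) := Real.rpow_nonneg hn₁0 _
    have : 0 ≤ C₂ * 2 ^ (α / 2) := by positivity
    linarith
  refine ⟨C₃ ^ ((1 + θ) / (2 * θ)), Real.one_le_rpow hC₃1 (by positivity), ?_⟩
  rintro p hp hinv hlow ⟨A₀, hA₀⟩
  have hscaled : ∀ k : ℕ, 1 ≤ k → ∀ B : ℝ, tail p k ≤ B * (k : ℝ) ^ (-θ) ↔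
      (k : ℝ) ^ θ * tail p k ≤ B := fun k hk B => by
    have hk0 : (0 : ℝ) < k := by exact_mod_cast hk
    rw [Real.rpow_neg hk0.le, ← div_eq_mul_inv, le_div_iff₀ (Real.rpow_pos_of_pos hk0 _), mul_comm]
  -- The best constant in the power-law bound.
  set A : ℝ := ⨆ k : ℕ, ((k + 1 : ℕ) : ℝ) ^ θ * tail p (k + 1) with hA
  have hbdd : BddAbove (Set.range fun k : ℕ => ((k + 1 : ℕ) : ℝ) ^ θ * tail p (k + 1)) :=
    ⟨A₀, by rintro _ ⟨k, rfl⟩; exact (hscaled (k + 1) (by omega) A₀).1 (hA₀ (k + 1) (by omega))⟩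
  have hle : ∀ k : ℕ, 1 ≤ k → (k : ℝ) ^ θ * tail p k ≤ A := fun k hk => by
    obtain ⟨j, rfl⟩ := Nat.exists_eq_add_of_le' hk
    exact le_ciSup hbdd j
  have hA1 : 1 ≤ A := by simpa [tail_one hp] using hle 1 le_rfl
  have htail : ∀ k : ℕ, 1 ≤ k → tail p k ≤ A * (k : ℝ) ^ (-θ) := fun k hk =>
    (hscaled k hk A).2 (hle k hk)
  have hApow1 : 1 ≤ A ^ (2 / (1 + θ)) := Real.one_le_rpow hA1 (by positivity)
  have hApowA : A ≤ A ^ (2 / (1 + θ)) := by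
    conv_lhs => rw [← Real.rpow_one A]
    refine Real.rpow_le_rpow_of_exponent_le hA1 ?_
    rw [le_div_iff₀ h1θ]; linarith
  have hsq : ∀ n : ℕ, 1 ≤ n → ((n : ℝ) ^ θ * tail p n) ^ 2 ≤ C₃ * A ^ (2 / (1 + θ)) := by
    intro n hn
    have hn0 : (0 : ℝ) < n := by exact_mod_cast hn
    have hn1 : (1 : ℝ) ≤ n := by exact_mod_cast hn
    have hnθ : ((n : ℝ) ^ θ) ^ 2 = (n : ℝ) ^ (2 * θ) := by
      rw [← Real.rpow_natCast, ← Real.rpow_mul hn0.le]; congr 1; push_cast; ring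
    have hn₁p : 0 ≤ n₁ ^ (2 * θ) := Real.rpow_nonneg hn₁0 _
    have hC₂p : 0 ≤ C₂ * 2 ^ (α / 2) := by positivity
    rw [mul_pow, hnθ]
    rcases le_or_gt n₁ n with hcase | hcase
    · set Y : ℝ := (n : ℝ) ^ ((1 + θ) / d) with hY
      have hY1 : 1 ≤ Y := Real.one_le_rpow hn1 (by positivity)
      set m := ⌈Y⌉₊ with hm
      have hYm : Y ≤ m := Nat.le_ceil Y
      have hm1 : 1 ≤ m := by
        have : (1 : ℝ) ≤ m := hY1.trans hYm
        exact_mod_cast this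
      have hm0 : (0 : ℝ) < m := by exact_mod_cast hm1
      have hm2 : (m : ℝ) ≤ 2 * Y := by
        have := Nat.ceil_lt_add_one (zero_le_one.trans hY1)
        linarith
      have hm₀m : m₀ ≤ m := by
        have h1 := Real.rpow_le_rpow hn₁0 hcase (show 0 ≤ (1 + θ) / d by positivity)
        rw [hn₁, ← Real.rpow_mul (Nat.cast_nonneg _),
          show (d : ℝ) / (1 + θ) * ((1 + θ) / d) = 1 by field_simp, Real.rpow_one] at h1
        exact_mod_cast h1.trans hYm
      have main := tail_sq_le hd hp hinv hκ hm1 (hlow m hm1 hm₀m) hθ0 hθ hA1 htail hn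
      rw [← hC₁, ← hC₂] at main
      have e1 : (m : ℝ) ^ (-(2 * d * θ / (1 + θ))) ≤ (n : ℝ) ^ (-(2 * θ)) := by
        refine (Real.rpow_le_rpow_of_nonpos (by linarith) hYm ?_).trans (le_of_eq ?_)
        · rw [neg_nonpos]; positivity
        · rw [hY, ← Real.rpow_mul hn0.le]; congr 1; field_simp
      have e2 : (m : ℝ) ^ (α / 2) * (n : ℝ) ^ (-(1 / 2) - θ) ≤
          2 ^ (α / 2) * (n : ℝ) ^ (-(2 * θ)) := by
        have h1 := Real.rpow_le_rpow hm0.le hm2 (show 0 ≤ α / 2 by positivity)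
        rw [Real.mul_rpow (by norm_num) (by linarith), hY, ← Real.rpow_mul hn0.le] at h1
        refine (mul_le_mul_of_nonneg_right h1 (Real.rpow_nonneg hn0.le _)).trans (le_of_eq ?_)
        rw [mul_assoc, ← Real.rpow_add hn0]
        congr 2
        rw [hθdef]
        field_simp
        ring
      have k1 := mul_le_mul_of_nonneg_left e1 (mul_nonneg hC₁0 (zero_le_one.trans hApow1))
      have k2 := mul_le_mul_of_nonneg_left e2 (mul_nonneg hC₂0 (zero_le_one.trans hA1))
      have k3 := mul_le_mul_of_nonneg_left hApowA hC₂p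
      have k4 : tail p n ^ 2 ≤ (C₁ + C₂ * 2 ^ (α / 2)) * A ^ (2 / (1 + θ)) *
          (n : ℝ) ^ (-(2 * θ)) := by
        have k5 := mul_le_mul_of_nonneg_right k3 (Real.rpow_nonneg hn0.le (-(2 * θ)))
        nlinarith
      have k6 := mul_le_mul_of_nonneg_left k4 (Real.rpow_nonneg hn0.le (2 * θ))
      have k7 : (n : ℝ) ^ (2 * θ) * ((C₁ + C₂ * 2 ^ (α / 2)) * A ^ (2 / (1 + θ)) *
          (n : ℝ) ^ (-(2 * θ))) = (C₁ + C₂ * 2 ^ (α / 2)) * A ^ (2 / (1 + θ)) := by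
        rw [Real.rpow_neg hn0.le]
        have := (Real.rpow_pos_of_pos hn0 (2 * θ)).ne'
        field_simp
      rw [k7] at k6
      refine k6.trans (mul_le_mul_of_nonneg_right ?_ (zero_le_one.trans hApow1))
      linarith
    · have h1 : (n : ℝ) ^ (2 * θ) ≤ n₁ ^ (2 * θ) :=
        Real.rpow_le_rpow hn0.le hcase.le (by positivity)
      have h2 : tail p n ^ 2 ≤ 1 := pow_le_one₀ (tail_nonneg hp n) (tail_le_one hp n)
      have h3 : (n : ℝ) ^ (2 * θ) * tail p n ^ 2 ≤ n₁ ^ (2 * θ) * 1 :=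
        mul_le_mul h1 h2 (sq_nonneg _) hn₁p
      calc _ ≤ n₁ ^ (2 * θ) * 1 := h3
        _ ≤ C₃ * A ^ (2 / (1 + θ)) := mul_le_mul (by linarith) hApow1 zero_le_one (by linarith)
  have hAsq : A ^ 2 ≤ C₃ * A ^ (2 / (1 + θ)) := by
    have h0 : 0 ≤ C₃ * A ^ (2 / (1 + θ)) := by positivity
    have : A ≤ √(C₃ * A ^ (2 / (1 + θ))) := ciSup_le fun k =>
      Real.le_sqrt_of_sq_le (hsq (k + 1) (by omega))
    calc A ^ 2 ≤ √(C₃ * A ^ (2 / (1 + θ))) ^ 2 := pow_le_pow_left₀ (by linarith) this 2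
      _ = _ := Real.sq_sqrt h0
  have hA0 : 0 < A := by linarith
  have hApos : 0 < A ^ (2 / (1 + θ)) := by linarith
  have hAθ : A ^ (2 * θ / (1 + θ)) ≤ C₃ := by
    have h1 : A ^ 2 = A ^ (2 * θ / (1 + θ)) * A ^ (2 / (1 + θ)) := by
      rw [← Real.rpow_add hA0, ← Real.rpow_natCast]
      congr 1
      push_cast
      field_simp
      ring
    rw [h1] at hAsq
    exact le_of_mul_le_mul_right hAsq hApos
  have hAC : A ≤ C₃ ^ ((1 + θ) / (2 * θ)) := by
    have h1 := Real.rpow_le_rpow (Real.rpow_nonneg hA0.le _) hAθ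
      (show 0 ≤ (1 + θ) / (2 * θ) by positivity)
    rwa [← Real.rpow_mul hA0.le, show 2 * θ / (1 + θ) * ((1 + θ) / (2 * θ)) = 1 by field_simp,
      Real.rpow_one] at h1
  exact fun k hk => (hscaled k hk _).2 ((hle k hk).trans hAC)

end Bootstrap

/-! ### Infinite-volume percolation as a limit of finite volumes -/

section Percolation

variable {d : ℕ} {J : (Fin d → ℤ) → ℝ≥0} {hJ : ∀ x, J (-x) = J x} {β : ℝ≥0}

/-- The probability that the pair `e` is open under `perc J hJ β`. -/
noncomputable def edgeProb (J : (Fin d → ℤ) → ℝ≥0) (hJ : ∀ x, J (-x) = J x) (β : ℝ≥0)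
    (e : Sym2 (Fin d → ℤ)) : ℝ :=
  1 - Real.exp (-((β : ℝ) * (pairIntensity J hJ e : ℝ)))

theorem openProb_eq_edgeProb (e : Sym2 (Fin d → ℤ)) :
    ((openProb (β * pairIntensity J hJ e) : unitInterval) : ℝ) = edgeProb J hJ β e := by
  simp [openProb, edgeProb]

theorem edgeProb_mem_Icc (e : Sym2 (Fin d → ℤ)) : edgeProb J hJ β e ∈ Set.Icc (0 : ℝ) 1 := by
  rw [← openProb_eq_edgeProb]; exact (openProb _).2

theorem edgeProb_mk (x y : Fin d → ℤ) :
    edgeProb J hJ β s(x, y) = 1 - Real.exp (-((β : ℝ) * (J (y - x) : ℝ))) := rfl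

theorem edgeProb_shift (v : Fin d → ℤ) (e : Sym2 (Fin d → ℤ)) :
    edgeProb J hJ β (shift v e) = edgeProb J hJ β e := by
  induction e with
  | h x y => rw [shift_mk, edgeProb_mk, edgeProb_mk, add_sub_add_left_eq_sub]

theorem edgeProb_mono {β' : ℝ≥0} (h : β ≤ β') (e : Sym2 (Fin d → ℤ)) :
    edgeProb J hJ β e ≤ edgeProb J hJ β' e := by
  have h1 : (β : ℝ) * (pairIntensity J hJ e : ℝ) ≤ β' * (pairIntensity J hJ e : ℝ) :=
    mul_le_mul_of_nonneg_right (by exact_mod_cast h) (NNReal.coe_nonneg _)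
  unfold edgeProb
  have := Real.exp_le_exp.2 (neg_le_neg h1)
  linarith

theorem continuous_edgeProb (e : Sym2 (Fin d → ℤ)) : Continuous fun β => edgeProb J hJ β e := by
  unfold edgeProb
  fun_prop

/-- The open edges among the edges of `F`. -/
def openIn {E : Type*} (F : Finset E) (ω : E → Bool) : Finset E := F.filter fun e => ω e = true

theorem openIn_mono {E : Type*} {F F' : Finset E} (h : F ⊆ F') (ω : E → Bool) :
    openIn F ω ⊆ openIn F' ω := Finset.filter_subset_filter _ h

theorem setOf_openIn_eq {E : Type*} [DecidableEq E] {F S : Finset E} (hS : S ⊆ F) :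
    {ω : E → Bool | openIn F ω = S} = Set.pi (F : Set E) fun e => {decide (e ∈ S)} := by
  ext ω
  simp only [Set.mem_ofPred_eq, Set.mem_pi, Finset.mem_coe, Set.mem_singleton_iff, openIn]
  constructor
  · rintro rfl e he
    cases h : ω e <;> simp [h, he]
  · intro h
    ext e
    rw [Finset.mem_filter]
    constructor
    · rintro ⟨he, hω⟩
      rw [h e he] at hω
      exact of_decide_eq_true hω
    · intro he
      exact ⟨hS he, by rw [h e (hS he)]; exact decide_eq_true he⟩

theorem setOf_openIn {E : Type*} (F : Finset E) (Q : Finset E → Prop) :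
    {ω : E → Bool | Q (openIn F ω)} =
      ⋃ S ∈ F.powerset, {ω : E → Bool | openIn F ω = S ∧ Q S} := by
  ext ω
  simp only [Set.mem_ofPred_eq, Set.mem_iUnion, Finset.mem_powerset, exists_prop]
  constructor
  · exact fun h => ⟨_, Finset.filter_subset _ _, rfl, h⟩
  · rintro ⟨S, -, rfl, h⟩
    exact h

theorem measurableSet_setOf_openIn {E : Type*} (F : Finset E) (Q : Finset E → Prop) :
    MeasurableSet {ω : E → Bool | Q (openIn F ω)} := by
  classical
  rw [setOf_openIn]
  refine Finset.measurableSet_biUnion _ fun S hS => ?_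
  by_cases hQ : Q S
  · simp only [hQ, and_true]
    rw [setOf_openIn_eq (Finset.mem_powerset.1 hS)]
    exact MeasurableSet.pi (Finset.countable_toSet F) fun _ _ => measurableSet_singleton _
  · simp [hQ]

theorem perc_real_openIn_eq {F S : Finset (Sym2 (Fin d → ℤ))} (hS : S ⊆ F) :
    (perc J hJ β).real {ω | openIn F ω = S} =
      (∏ e ∈ S, edgeProb J hJ β e) * ∏ e ∈ F \ S, (1 - edgeProb J hJ β e) := by
  rw [setOf_openIn_eq hS, Measure.real, perc,
    Measure.infinitePi_pi _ fun _ _ => measurableSet_singleton _, ENNReal.toReal_prod,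
    ← Finset.prod_sdiff hS, mul_comm]
  congr 1
  · refine Finset.prod_congr rfl fun e he => ?_
    rw [← openProb_eq_edgeProb, ← Measure.real]
    exact bernoulliMeasure_real_apply_of_mem_of_notMem _ (measurableSet_singleton _)
      (by simp [he]) (by simp [he])
  · refine Finset.prod_congr rfl fun e he => ?_
    have he' := (Finset.mem_sdiff.1 he).2
    rw [← openProb_eq_edgeProb, ← Measure.real]
    rw [bernoulliMeasure_real_apply_of_notMem_of_mem _ (measurableSet_singleton _)
      (by simp [he']) (by simp [he'])]

theorem perc_real_openIn (F : Finset (Sym2 (Fin d → ℤ))) (Q : Finset (Sym2 (Fin d → ℤ)) → Prop) :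
    (perc J hJ β).real {ω | Q (openIn F ω)} = bernProb (edgeProb J hJ β) F Q := by
  classical
  have hmeas : ∀ S ∈ F.powerset, MeasurableSet
      {ω : Sym2 (Fin d → ℤ) → Bool | openIn F ω = S ∧ Q S} := fun S _ =>
    measurableSet_setOf_openIn F fun T => T = S ∧ Q S
  rw [setOf_openIn, measureReal_biUnion_finset ?_ hmeas]
  · refine Finset.sum_congr rfl fun S hS => ?_
    by_cases hQ : Q S
    · simp only [hQ, and_true, if_true, mul_one]
      exact perc_real_openIn_eq (Finset.mem_powerset.1 hS)
    · simp [hQ]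
  · intro S _ T _ hST
    refine Set.disjoint_left.2 ?_
    rintro ω ⟨h1, -⟩ ⟨h2, -⟩
    exact hST (h1.symm.trans h2)

theorem tendsto_bernProb_perc {Q : Finset (Sym2 (Fin d → ℤ)) → Prop} (hQ : Increasing Q) :
    Filter.Tendsto (fun F => bernProb (edgeProb J hJ β) F Q) Filter.atTop
      (nhds ((perc J hJ β).real {ω | ∃ F, Q (openIn F ω)})) := by
  have hmono : Monotone fun F : Finset (Sym2 (Fin d → ℤ)) =>
      {ω : Sym2 (Fin d → ℤ) → Bool | Q (openIn F ω)} := fun F F' h ω hω => hQ (openIn_mono h ω) hω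
  have h1 := tendsto_measure_iUnion_atTop (μ := perc J hJ β) hmono
  have h2 := (ENNReal.tendsto_toReal (measure_ne_top (perc J hJ β) _)).comp h1
  have h3 : (⋃ F, {ω : Sym2 (Fin d → ℤ) → Bool | Q (openIn F ω)}) =
      {ω | ∃ F, Q (openIn F ω)} := by ext; simp
  rw [h3] at h2
  refine h2.congr fun F => ?_
  exact perc_real_openIn F Q

theorem Conn.mem_cluster {F : Finset (Sym2 (Fin d → ℤ))} {ω : Sym2 (Fin d → ℤ) → Bool}
    {x y : Fin d → ℤ} (h : Conn (openIn F ω) x y) : y ∈ cluster ω x :=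
  SimpleGraph.Reachable.mono (SimpleGraph.fromEdgeSet_mono fun _ he =>
    (Finset.mem_filter.1 (Finset.mem_coe.1 he)).2) h

theorem mem_cluster_iff {ω : Sym2 (Fin d → ℤ) → Bool} {x y : Fin d → ℤ} :
    y ∈ cluster ω x ↔ ∃ F, Conn (openIn F ω) x y := by
  refine ⟨fun h => ?_, fun ⟨F, h⟩ => h.mem_cluster⟩
  have h' := (SimpleGraph.reachable_iff_reflTransGen _ _).1 h
  clear h
  induction h' with
  | refl => exact ⟨∅, Conn.refl _ _⟩
  | @tail a b h1 h2 ih =>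
    obtain ⟨F, hF⟩ := ih
    have hab : ω s(a, b) = true := ((SimpleGraph.fromEdgeSet_adj _).1 h2).1
    refine ⟨insert s(a, b) F, (hF.mono (openIn_mono (Finset.subset_insert _ _) ω)).trans
      (Conn.of_mem ?_)⟩
    exact Finset.mem_filter.2 ⟨Finset.mem_insert_self _ _, hab⟩

theorem le_encard_cluster_iff {ω : Sym2 (Fin d → ℤ) → Bool} {x : Fin d → ℤ} {n : ℕ} :
    (n : ℕ∞) ≤ (cluster ω x).encard ↔ ∃ F, n ≤ (clus (openIn F ω) {x}).card := by
  constructor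
  · intro h
    obtain ⟨T, hT, hTn⟩ := Set.exists_subset_encard_eq h
    have hfin : T.Finite := Set.finite_of_encard_eq_coe hTn
    choose! G hG using fun y (hy : y ∈ T) => mem_cluster_iff.1 (hT hy)
    refine ⟨hfin.toFinset.biUnion G, ?_⟩
    have h1 : hfin.toFinset ⊆ clus (openIn (hfin.toFinset.biUnion G) ω) {x} := fun y hy =>
      mem_clus_singleton.2 ((hG y (hfin.mem_toFinset.1 hy)).mono
        (openIn_mono (Finset.subset_biUnion_of_mem G hy) ω))
    refine le_trans (le_of_eq ?_) (Finset.card_le_card h1)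
    rw [hfin.encard_eq_coe_toFinset_card] at hTn
    exact_mod_cast hTn.symm
  · rintro ⟨F, hF⟩
    have h1 : ((clus (openIn F ω) {x} : Finset _) : Set (Fin d → ℤ)) ⊆ cluster ω x := fun y hy =>
      (mem_clus_singleton.1 (Finset.mem_coe.1 hy)).mem_cluster
    refine le_trans ?_ (Set.encard_le_encard h1)
    rw [Set.encard_coe_eq_coe_finsetCard]
    exact_mod_cast hF

theorem increasing_conn {V : Type*} (x y : V) : Increasing fun S : Finset (Sym2 V) => Conn S x y :=
  fun _ _ h hc => hc.mono h

theorem perc_real_le_encard_cluster_le {x : Fin d → ℤ} {n : ℕ} {t : ℝ}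
    (ht : tail (edgeProb J hJ β) n ≤ t) :
    (perc J hJ β).real {ω | (n : ℕ∞) ≤ (cluster ω x).encard} ≤ t := by
  simp only [le_encard_cluster_iff]
  exact le_of_tendsto' (tendsto_bernProb_perc (increasing_le_card_clus {x} n)) fun F =>
    (bernProb_le_tail edgeProb_mem_Icc edgeProb_shift F n x).trans ht

theorem tail_le_perc_real (n : ℕ) : tail (edgeProb J hJ β) n ≤
    (perc J hJ β).real {ω | (n : ℕ∞) ≤ (cluster ω 0).encard} := by
  refine ciSup_le fun F => ?_
  rw [← perc_real_openIn]
  exact measureReal_mono fun ω hω => le_encard_cluster_iff.2 ⟨F, hω⟩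

theorem measurableSet_le_encard_cluster (x : Fin d → ℤ) (n : ℕ) :
    MeasurableSet {ω : Sym2 (Fin d → ℤ) → Bool | (n : ℕ∞) ≤ (cluster ω x).encard} := by
  simp only [le_encard_cluster_iff, Set.ofPred_exists]
  exact MeasurableSet.iUnion fun F => measurableSet_setOf_openIn F fun S => n ≤ (clus S {x}).card

/-- If clusters are finite, the tail of the cluster size vanishes at infinity. -/
theorem tendsto_tail_zero (h : ∀ᵐ ω ∂(perc J hJ β), ∀ x, (cluster ω x).Finite) :
    Filter.Tendsto (tail (edgeProb J hJ β)) Filter.atTop (nhds 0) := by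
  have h1 : Filter.Tendsto (fun n : ℕ => perc J hJ β {ω | (n : ℕ∞) ≤ (cluster ω 0).encard})
      Filter.atTop (nhds (perc J hJ β (⋂ n : ℕ, {ω | (n : ℕ∞) ≤ (cluster ω 0).encard}))) := by
    refine tendsto_measure_iInter_atTop
      (fun n => (measurableSet_le_encard_cluster 0 n).nullMeasurableSet) ?_
      ⟨0, measure_ne_top _ _⟩
    intro m n hmn ω hω
    exact le_trans (show (m : ℕ∞) ≤ n by exact_mod_cast hmn) (show (n : ℕ∞) ≤ _ from hω)
  have h2 : perc J hJ β (⋂ n : ℕ, {ω | (n : ℕ∞) ≤ (cluster ω 0).encard}) = 0 := by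
    refine measure_mono_null (fun ω hω => ?_) h
    rw [Set.mem_iInter] at hω
    intro hfin
    have h3 := hω ((hfin 0).toFinset.card + 1)
    rw [Set.mem_ofPred_eq, (hfin 0).encard_eq_coe_toFinset_card] at h3
    have h4 : (hfin 0).toFinset.card + 1 ≤ (hfin 0).toFinset.card := by exact_mod_cast h3
    omega
  rw [h2] at h1
  have h5 := (ENNReal.tendsto_toReal ENNReal.zero_ne_top).comp h1
  exact squeeze_zero (tail_nonneg edgeProb_mem_Icc) tail_le_perc_real h5

/-- Below a parameter without infinite clusters the cluster size has exponential tails, and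
in particular a power-law tail of any exponent `θ ≤ 1`. -/
theorem exists_tail_bound_of_lt (hint : Summable J) {β' : ℝ≥0} (hβ : β < β')
    (h : ∀ᵐ ω ∂(perc J hJ β'), ∀ x, (cluster ω x).Finite) {θ : ℝ} (hθ : θ ≤ 1) :
    ∃ A : ℝ, ∀ k : ℕ, 1 ≤ k → tail (edgeProb J hJ β) k ≤ A * (k : ℝ) ^ (-θ) := by
  have hβ'0 : (0 : ℝ) < β' := by exact_mod_cast (zero_le (a := β)).trans_lt hβ
  have hββ : (0 : ℝ) < β' - β := sub_pos.2 (by exact_mod_cast hβ)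
  set Jm : ℝ := ((∑' x, J x : ℝ≥0) : ℝ) with hJm
  have hJle : ∀ e, (pairIntensity J hJ e : ℝ) ≤ Jm := fun e => by
    induction e with
    | h x y =>
      have : J (y - x) ≤ ∑' x, J x := hint.le_tsum _ fun _ _ => zero_le
      exact_mod_cast this
  -- The relative decrease of the edge probabilities between `β'` and `β` is at least `δ`.
  set δ : ℝ := (β' - β) * Real.exp (-(β' * Jm)) / (β' * 2) with hδ
  have hδ0 : 0 < δ := by positivity
  have hδ1 : δ ≤ 1 / 2 := by
    have h1 : Real.exp (-(β' * Jm)) ≤ 1 := Real.exp_le_one_iff.2 (by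
      have : 0 ≤ Jm := NNReal.coe_nonneg _
      have := mul_nonneg hβ'0.le this
      linarith)
    have h2 : (β' - β : ℝ) ≤ β' := by linarith [NNReal.coe_nonneg β]
    rw [hδ, div_le_div_iff₀ (by positivity) (by norm_num)]
    have := mul_le_mul h2 h1 (Real.exp_pos _).le hβ'0.le
    linarith
  have hqp : ∀ e, edgeProb J hJ β e ≤ (1 - δ) * edgeProb J hJ β' e := by
    intro e
    set t : ℝ := (pairIntensity J hJ e : ℝ) with ht
    have ht0 : 0 ≤ t := NNReal.coe_nonneg _
    have h1 : edgeProb J hJ β' e ≤ β' * t := by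
      have := Real.add_one_le_exp (-((β' : ℝ) * t))
      unfold edgeProb
      linarith
    have h2 : (β' - β) * t * Real.exp (-(β' * Jm)) ≤
        Real.exp (-((β : ℝ) * t)) - Real.exp (-((β' : ℝ) * t)) := by
      have h3 : Real.exp (-((β : ℝ) * t)) =
          Real.exp (-((β' : ℝ) * t)) * Real.exp ((β' - β) * t) := by
        rw [← Real.exp_add]; congr 1; ring
      have h4 := Real.add_one_le_exp ((β' - β : ℝ) * t)
      have h5 : Real.exp (-((β' : ℝ) * Jm)) ≤ Real.exp (-((β' : ℝ) * t)) :=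
        Real.exp_le_exp.2 (neg_le_neg (mul_le_mul_of_nonneg_left (hJle e) hβ'0.le))
      have h6 := mul_le_mul_of_nonneg_left h5 (mul_nonneg hββ.le ht0)
      have h7 := mul_le_mul_of_nonneg_left h4 (Real.exp_pos (-((β' : ℝ) * t))).le
      rw [h3]
      linarith
    have h8 : δ * edgeProb J hJ β' e ≤ (β' - β) * t * Real.exp (-(β' * Jm)) := by
      have h9 : δ * edgeProb J hJ β' e ≤ δ * (β' * t) := mul_le_mul_of_nonneg_left h1 hδ0.le
      have h10 : δ * (β' * t) = (β' - β) * t * Real.exp (-(β' * Jm)) / 2 := by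
        rw [hδ]; field_simp
      have h11 : 0 ≤ (β' - β) * t * Real.exp (-(β' * Jm)) := by positivity
      linarith
    have h12 : edgeProb J hJ β' e - edgeProb J hJ β e =
        Real.exp (-((β : ℝ) * t)) - Real.exp (-((β' : ℝ) * t)) := by
      unfold edgeProb; ring
    linarith
  obtain ⟨n, hn1, hn⟩ : ∃ n : ℕ, 1 ≤ n ∧ tail (edgeProb J hJ β') n ≤ δ / 2 := by
    have := ((tendsto_tail_zero h).eventually (Iic_mem_nhds (show 0 < δ / 2 by positivity))).and
      (Filter.eventually_ge_atTop 1)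
    obtain ⟨n, h1, h2⟩ := this.exists
    exact ⟨n, h2, h1⟩
  have hn0 : (0 : ℝ) < n := by exact_mod_cast hn1
  have hn1' : (1 : ℝ) ≤ n := by exact_mod_cast hn1
  -- The weight `s` is chosen with `1 - δ / 2 ≤ s ^ n`, by Bernoulli's inequality.
  set s : ℝ := 1 - δ / 2 / n with hs
  have hδn : δ / 2 / n ≤ 1 / 2 := by
    rw [div_le_iff₀ hn0]; nlinarith
  have hδn0 : 0 < δ / 2 / n := by positivity
  have hsn : 1 - δ / 2 ≤ s ^ n := by
    have := one_add_mul_le_pow (a := -(δ / 2 / n)) (by linarith) n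
    rw [hs, sub_eq_add_neg 1 (δ / 2 / n)]
    refine le_trans (le_of_eq ?_) this
    field_simp
    ring
  have hs01 : s ∈ Set.Icc (0 : ℝ) 1 := ⟨by linarith, by linarith⟩
  have hc : ∀ F y, 1 - δ ≤ bernExp (edgeProb J hJ β') F fun S => s ^ (clus S {y}).card := by
    classical
    intro F y
    have h1 := (bernProb_le_tail (p := edgeProb J hJ β') edgeProb_mem_Icc edgeProb_shift F n y).trans
      hn
    have h2 : bernExp (edgeProb J hJ β') F (fun S => s ^ n - if n ≤ (clus S {y}).card then 1 else 0) ≤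
        bernExp (edgeProb J hJ β') F fun S => s ^ (clus S {y}).card := by
      refine bernExp_le edgeProb_mem_Icc fun S _ => ?_
      split_ifs with hS
      · have := pow_le_one₀ hs01.1 hs01.2 (n := n)
        have := pow_nonneg hs01.1 (clus S {y}).card
        linarith
      · rw [sub_zero]
        exact pow_le_pow_of_le_one hs01.1 hs01.2 (not_le.1 hS).le
    rw [bernExp_sub, bernExp_const] at h2
    have h3 : bernExp (edgeProb J hJ β') F (fun S => if n ≤ (clus S {y}).card then (1 : ℝ) else 0) =
        bernProb (edgeProb J hJ β') F (fun S => n ≤ (clus S {y}).card) := by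
      refine bernExp_congr fun S _ => ?_
      by_cases hS : n ≤ (clus S {y}).card <;> simp [hS]
    rw [h3] at h2
    linarith
  have hexp : ∀ k, tail (edgeProb J hJ β) k ≤ 2 * s ^ k := fun k => ciSup_le fun F => by
    have h1 := bernProb_le_card_clus_le_pow edgeProb_mem_Icc edgeProb_mem_Icc hs01 hc hqp k F 0
    have h2 : 1 / 2 * bernProb (edgeProb J hJ β) F (fun S => k ≤ (clus S {0}).card) ≤
        (1 - δ) * bernProb (edgeProb J hJ β) F (fun S => k ≤ (clus S {0}).card) :=
      mul_le_mul_of_nonneg_right (by linarith) (bernProb_nonneg edgeProb_mem_Icc _)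
    linarith
  obtain ⟨B, hB⟩ := (tendsto_self_mul_const_pow_of_lt_one hs01.1
    (by linarith : s < 1)).bddAbove_range
  refine ⟨2 * B, fun k hk => (hexp k).trans ?_⟩
  have hk0 : (0 : ℝ) < k := by exact_mod_cast hk
  have hk1 : (1 : ℝ) ≤ k := by exact_mod_cast hk
  have h1 : (k : ℝ) * s ^ k ≤ B := hB ⟨k, rfl⟩
  have h2 : (k : ℝ) ^ θ ≤ k := by
    conv_rhs => rw [← Real.rpow_one (k : ℝ)]
    exact Real.rpow_le_rpow_of_exponent_le hk1 hθ
  rw [Real.rpow_neg hk0.le, ← div_eq_mul_inv, le_div_iff₀ (Real.rpow_pos_of_pos hk0 _)]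
  have h3 := mul_le_mul_of_nonneg_right h2 (pow_nonneg hs01.1 k)
  linarith

end Percolation

/-! ### Long-range lower bounds on the edge probabilities -/

section LowerBound

variable {d : ℕ} {J : (Fin d → ℤ) → ℝ≥0} {hJ : ∀ x, J (-x) = J x} {α c r₀ : ℝ}

theorem l1norm_bounds_of_mem_orthantCube (hd : 1 ≤ d) {m : ℕ} {x : Fin d → ℤ}
    (hx : x ∈ orthantCube d m) : (m : ℝ) ≤ l1norm x ∧ l1norm x ≤ 2 * d * m := by
  have hx' := mem_orthantCube.1 hx
  have h1 : ∀ i, (m : ℝ) ≤ |(x i : ℝ)| ∧ |(x i : ℝ)| ≤ 2 * m := fun i => by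
    obtain ⟨h1, h2⟩ := hx' i
    have h1' : (m : ℝ) ≤ x i := by exact_mod_cast h1
    have h2' : (x i : ℝ) ≤ 2 * m := by exact_mod_cast h2
    rw [abs_of_nonneg ((Nat.cast_nonneg m).trans h1')]
    exact ⟨h1', h2'⟩
  constructor
  · exact (h1 ⟨0, hd⟩).1.trans (Finset.single_le_sum (f := fun i => |(x i : ℝ)|)
      (fun i _ => abs_nonneg _) (Finset.mem_univ _))
  · refine (Finset.sum_le_card_nsmul _ _ (2 * (m : ℝ)) fun i _ => (h1 i).2).trans (le_of_eq ?_)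
    rw [Finset.card_univ, Fintype.card_fin, nsmul_eq_mul]
    ring

theorem le_J_of_mem_orthantCube (hd : 1 ≤ d) (hc : 0 < c) (hαd : 0 ≤ (d : ℝ) + α)
    (hlow : ∀ x : Fin d → ℤ, r₀ ≤ l1norm x → c * l1norm x ^ (-(d : ℝ) - α) ≤ (J x : ℝ))
    {m : ℕ} (hm : 1 ≤ m) (hmr : r₀ ≤ m) {x : Fin d → ℤ} (hx : x ∈ orthantCube d m) :
    c * (2 * d * m : ℝ) ^ (-(d : ℝ) - α) ≤ J x := by
  obtain ⟨h1, h2⟩ := l1norm_bounds_of_mem_orthantCube hd hx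
  have hm0 : (0 : ℝ) < m := by exact_mod_cast hm
  refine le_trans (mul_le_mul_of_nonneg_left ?_ hc.le) (hlow x (hmr.trans h1))
  exact Real.rpow_le_rpow_of_nonpos (hm0.trans_le h1) h2 (by linarith)

/-- If `α ≤ 0` the intensities in the cubes `[m, 2m]^d` have sums bounded below, so a summable `J`
forces `α > 0`. -/
theorem alpha_pos (hd : 1 ≤ d) (hint : Summable J) (hc : 0 < c)
    (hlow : ∀ x : Fin d → ℤ, r₀ ≤ l1norm x → c * l1norm x ^ (-(d : ℝ) - α) ≤ (J x : ℝ)) :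
    0 < α := by
  by_contra! hα
  have hd0 : (0 : ℝ) < d := by exact_mod_cast hd
  have hlow' : ∀ x : Fin d → ℤ, max r₀ 1 ≤ l1norm x →
      c * l1norm x ^ (-(d : ℝ) - 0) ≤ (J x : ℝ) := fun x hx => by
    refine le_trans (mul_le_mul_of_nonneg_left ?_ hc.le) (hlow x ((le_max_left _ _).trans hx))
    exact Real.rpow_le_rpow_of_exponent_le ((le_max_right _ _).trans hx) (by linarith)
  have hintR : Summable fun x => (J x : ℝ) := NNReal.summable_coe.2 hint
  have hpos : 0 < c * (2 * d : ℝ) ^ (-(d : ℝ)) := by positivity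
  obtain ⟨s, hs⟩ := summable_iff_vanishing_norm.1 hintR _ hpos
  obtain ⟨R, hR⟩ := exists_subset_cube s
  set m := R + 1 + ⌈max r₀ 1⌉₊ with hm
  have hm1 : 1 ≤ m := by omega
  have hm0 : (0 : ℝ) < m := by exact_mod_cast hm1
  have hmr : max r₀ 1 ≤ m := (Nat.le_ceil _).trans (by exact_mod_cast (by omega))
  have hdisj : Disjoint (orthantCube d m) s := Finset.disjoint_left.2 fun x hx hxs => by
    have h1 := mem_cube.1 (hR hxs) ⟨0, hd⟩
    have h2 := mem_orthantCube.1 hx ⟨0, hd⟩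
    rw [abs_le] at h1
    omega
  have h1 := hs _ hdisj
  rw [Real.norm_of_nonneg (Finset.sum_nonneg fun x _ => NNReal.coe_nonneg _)] at h1
  have h2 := Finset.card_nsmul_le_sum (orthantCube d m) (fun x => (J x : ℝ)) _ fun x hx =>
    le_J_of_mem_orthantCube hd hc (by linarith) hlow' hm1 hmr hx
  have h3 : c * (2 * d : ℝ) ^ (-(d : ℝ)) ≤
      (orthantCube d m).card • (c * (2 * d * m : ℝ) ^ (-(d : ℝ) - 0)) := by
    rw [nsmul_eq_mul, card_orthantCube, sub_zero, Real.mul_rpow (by positivity) hm0.le,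
      Real.rpow_neg hm0.le, Real.rpow_natCast]
    have h4 : (m : ℝ) ^ d ≤ (((m + 1) ^ d : ℕ) : ℝ) := by
      push_cast
      exact pow_le_pow_left₀ hm0.le (by linarith) d
    have h5 : 1 ≤ (((m + 1) ^ d : ℕ) : ℝ) * ((m : ℝ) ^ d)⁻¹ := by
      rw [← div_eq_mul_inv, one_le_div (by positivity)]
      exact h4
    have h6 := mul_le_mul_of_nonneg_left h5 hpos.le
    linarith
  linarith

theorem exists_edgeProb_lower_bound (hd : 1 ≤ d) (hα : 0 < α) (hc : 0 < c)
    (hlow : ∀ x : Fin d → ℤ, r₀ ≤ l1norm x → c * l1norm x ^ (-(d : ℝ) - α) ≤ (J x : ℝ))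
    {β₀ : ℝ≥0} (hβ₀ : 0 < β₀) :
    ∃ κ : ℝ, 0 < κ ∧ ∀ β, β₀ ≤ β → ∀ m : ℕ, 1 ≤ m → ⌈r₀⌉₊ ≤ m → ∀ x, ∀ y ∈ orthantCube d m,
      κ * (m : ℝ) ^ (-(d : ℝ) - α) ≤ edgeProb J hJ β s(x, x + y) := by
  have hd0 : (0 : ℝ) < d := by exact_mod_cast hd
  have hβ₀' : (0 : ℝ) < β₀ := by exact_mod_cast hβ₀
  set t : ℝ := β₀ * (c * (2 * d : ℝ) ^ (-(d : ℝ) - α)) with ht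
  have ht0 : 0 < t := by positivity
  refine ⟨t / (1 + t), by positivity, fun β hβ m hm hmr x y hy => ?_⟩
  have hm0 : (0 : ℝ) < m := by exact_mod_cast hm
  have hm1 : (1 : ℝ) ≤ m := by exact_mod_cast hm
  set s : ℝ := (m : ℝ) ^ (-(d : ℝ) - α) with hs
  have hs0 : 0 < s := Real.rpow_pos_of_pos hm0 _
  have hs1 : s ≤ 1 := Real.rpow_le_one_of_one_le_of_nonpos hm1 (by linarith)
  refine le_trans ?_ (edgeProb_mono hβ _)
  rw [edgeProb_mk, add_sub_cancel_left]
  have h1 := le_J_of_mem_orthantCube hd hc (by linarith) hlow hm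
    ((Nat.le_ceil r₀).trans (by exact_mod_cast hmr)) hy
  rw [Real.mul_rpow (by positivity) hm0.le, ← hs] at h1
  have h2 : t * s ≤ β₀ * (J y : ℝ) := by
    have := mul_le_mul_of_nonneg_left h1 hβ₀'.le
    rw [ht]; linarith
  have hts : 0 < t * s := mul_pos ht0 hs0
  have h3 : Real.exp (-((β₀ : ℝ) * J y)) ≤ (1 + t * s)⁻¹ := by
    refine (Real.exp_le_exp.2 (neg_le_neg h2)).trans ?_
    rw [Real.exp_neg]
    have := Real.add_one_le_exp (t * s)
    exact inv_anti₀ (by linarith) (by linarith)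
  have h4 : t / (1 + t) * s ≤ 1 - (1 + t * s)⁻¹ := by
    have h5 : 1 - (1 + t * s)⁻¹ = t * s / (1 + t * s) := by field_simp; ring
    rw [h5, div_mul_eq_mul_div]
    exact div_le_div_of_nonneg_left hts.le (by linarith) (by nlinarith)
  linarith

/-- As `β → ∞`, the vertices joined to the origin by an edge of positive intensity belong to its
cluster with probability tending to one. -/
theorem exists_tail_gt (hd : 1 ≤ d) (hc : 0 < c)
    (hlow : ∀ x : Fin d → ℤ, r₀ ≤ l1norm x → c * l1norm x ^ (-(d : ℝ) - α) ≤ (J x : ℝ))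
    (n : ℕ) {t : ℝ} (ht : t < 1) : ∃ β : ℝ≥0, 1 ≤ β ∧ t < tail (edgeProb J hJ β) n := by
  set y : ℕ → (Fin d → ℤ) := fun i => fun _ => ((⌈r₀⌉₊ + 1 + i : ℕ) : ℤ) with hy
  have hyinj : Function.Injective y := fun i j hij => by
    have h1 : ((⌈r₀⌉₊ + 1 + i : ℕ) : ℤ) = ((⌈r₀⌉₊ + 1 + j : ℕ) : ℤ) := congrFun hij ⟨0, hd⟩
    have h2 : ⌈r₀⌉₊ + 1 + i = ⌈r₀⌉₊ + 1 + j := by exact_mod_cast h1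
    omega
  have hymem : ∀ i, y i ∈ orthantCube d (⌈r₀⌉₊ + 1 + i) := fun i =>
    mem_orthantCube.2 fun _ => ⟨le_rfl, by simp only [hy]; omega⟩
  have hyJ : ∀ i, 0 < (J (y i) : ℝ) := fun i => by
    obtain ⟨h1, -⟩ := l1norm_bounds_of_mem_orthantCube hd (hymem i)
    have h2 : (0 : ℝ) < ((⌈r₀⌉₊ + 1 + i : ℕ) : ℝ) := by positivity
    have h3 : r₀ ≤ ((⌈r₀⌉₊ + 1 + i : ℕ) : ℝ) :=
      (Nat.le_ceil r₀).trans (by exact_mod_cast (by omega))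
    have h4 : 0 < l1norm (y i) := h2.trans_le h1
    exact lt_of_lt_of_le (by positivity) (hlow (y i) (h3.trans h1))
  set F : Finset (Sym2 (Fin d → ℤ)) := (Finset.range n).image fun i => s(0, y i) with hF
  have hFn : n ≤ (clus F {0}).card := by
    have h1 : (Finset.range n).image y ⊆ clus F {0} := fun z hz => by
      obtain ⟨i, hi, rfl⟩ := Finset.mem_image.1 hz
      exact mem_clus_singleton.2 (Conn.of_mem (Finset.mem_image.2 ⟨i, hi, rfl⟩))
    have h2 := Finset.card_le_card h1
    rwa [Finset.card_image_of_injective _ hyinj, Finset.card_range] at h2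
  have hlim : Filter.Tendsto (fun k : ℕ => ∏ e ∈ F, edgeProb J hJ (k : ℝ≥0) e) Filter.atTop
      (nhds (∏ _e ∈ F, (1 : ℝ))) := by
    refine tendsto_finsetProd _ fun e he => ?_
    obtain ⟨i, -, rfl⟩ := Finset.mem_image.1 he
    simp only [edgeProb_mk, sub_zero]
    have h1 : Filter.Tendsto (fun k : ℕ => Real.exp (-(((k : ℝ≥0) : ℝ) * (J (y i) : ℝ))))
        Filter.atTop (nhds 0) := by
      refine Real.tendsto_exp_neg_atTop_nhds_zero.comp ?_
      refine Filter.Tendsto.atTop_mul_const (hyJ i) ?_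
      simpa using tendsto_natCast_atTop_atTop (R := ℝ)
    simpa using h1.const_sub 1
  rw [Finset.prod_const_one] at hlim
  obtain ⟨k, hk, hk1⟩ := ((hlim.eventually (lt_mem_nhds ht)).and
    (Filter.eventually_ge_atTop 1)).exists
  refine ⟨k, by exact_mod_cast hk1, hk.trans_le ?_⟩
  exact (prod_le_bernProb edgeProb_mem_Icc hFn).trans
    (le_ciSup (bddAbove_tail edgeProb_mem_Icc n) F)

end LowerBound

/-! ### The critical parameter -/

section Critical

variable {d : ℕ} {J : (Fin d → ℤ) → ℝ≥0} {hJ : ∀ x, J (-x) = J x} {β : ℝ≥0}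

theorem exists_finite_of_lt_betaC (h : (β : ℝ≥0∞) < betaC J hJ) :
    ∃ β' : ℝ≥0, β < β' ∧ ∀ᵐ ω ∂(perc J hJ β'), ∀ x, (cluster ω x).Finite := by
  obtain ⟨_, ⟨β', rfl, hβ'⟩, hlt⟩ := lt_sSup_iff.1 h
  exact ⟨β', by exact_mod_cast hlt, hβ'⟩

theorem tail_mono {β' : ℝ≥0} (h : β ≤ β') (n : ℕ) :
    tail (edgeProb J hJ β) n ≤ tail (edgeProb J hJ β') n := ciSup_le fun F =>
  (bernProb_mono_prob edgeProb_mem_Icc edgeProb_mem_Icc (fun e => edgeProb_mono h e)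
    (increasing_le_card_clus _ _)).trans (le_ciSup (bddAbove_tail edgeProb_mem_Icc n) F)

/-- The tail of the cluster size is left-continuous in `β`. -/
theorem tail_le_of_forall_lt {b : ℝ≥0} (hb : 0 < b) {n : ℕ} {t : ℝ}
    (h : ∀ β < b, tail (edgeProb J hJ β) n ≤ t) : tail (edgeProb J hJ b) n ≤ t := by
  refine ciSup_le fun F => ?_
  have hcl : IsClosed {β : ℝ≥0 | bernProb (edgeProb J hJ β) F
      (fun S => n ≤ (clus S {0}).card) ≤ t} :=
    isClosed_le (continuous_bernExp fun e => continuous_edgeProb e) continuous_const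
  have hsub : Set.Iio b ⊆ {β : ℝ≥0 | bernProb (edgeProb J hJ β) F
      (fun S => n ≤ (clus S {0}).card) ≤ t} := fun β hβ =>
    (le_ciSup (bddAbove_tail edgeProb_mem_Icc n) F).trans (h β hβ)
  have hmem : b ∈ closure (Set.Iio b) := by
    rw [closure_Iio' (⟨0, hb⟩ : (Set.Iio b).Nonempty)]; exact Set.mem_Iic.2 le_rfl
  exact closure_minimal hsub hcl hmem

theorem tail_edgeProb_zero_le {θ : ℝ} {k : ℕ} (hk : 1 ≤ k) :
    tail (edgeProb J hJ 0) k ≤ 1 * (k : ℝ) ^ (-θ) := by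
  rcases hk.eq_or_lt with rfl | hk
  · simpa using tail_le_one edgeProb_mem_Icc 1
  · have h0 : ∀ e, edgeProb J hJ 0 e = 0 := fun e => by simp [edgeProb]
    refine le_trans (ciSup_le fun F => ?_) (show (0 : ℝ) ≤ _ by positivity)
    induction F using Finset.induction_on with
    | empty =>
      have h1 : clus (∅ : Finset (Sym2 (Fin d → ℤ))) {0} = {0} := clus_eq_self (by simp)
      simp [bernProb, h1, not_le.2 hk]
    | insert e F he ih => simpa [bernProb_insert he, h0] using ih

/-- The two-point function averaged over a finite set `B`, for a power-law tail. -/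
theorem sum_two_point_le {θ C : ℝ} (hθ0 : 0 < θ) (hθ : θ < 1) (hC : 1 ≤ C)
    (htail : ∀ k : ℕ, 1 ≤ k → tail (edgeProb J hJ β) k ≤ C * (k : ℝ) ^ (-θ))
    {B : Finset (Fin d → ℤ)} (hB : 1 ≤ B.card) :
    ∑ x ∈ B, (perc J hJ β).real {ω | x ∈ cluster ω 0} ≤
      96 / (1 - θ) * C ^ (2 / (1 + θ)) * (B.card : ℝ) ^ ((1 - θ) / (1 + θ)) := by
  simp only [mem_cluster_iff]
  refine le_of_tendsto' (tendsto_finsetSum B fun x _ =>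
    tendsto_bernProb_perc (increasing_conn 0 x)) fun F => ?_
  rw [← bernExp_cardIn_eq]
  exact bernExp_cardIn_le_of_tail edgeProb_mem_Icc hB 0
    (fun k v => bernProb_le_tail edgeProb_mem_Icc edgeProb_shift F k v) hθ0 hθ hC htail

theorem ae_finite_of_tail {θ C : ℝ} (hθ0 : 0 < θ)
    (htail : ∀ k : ℕ, 1 ≤ k → tail (edgeProb J hJ β) k ≤ C * (k : ℝ) ^ (-θ)) :
    ∀ᵐ ω ∂(perc J hJ β), ∀ x, (cluster ω x).Finite := by
  rw [ae_all_iff]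
  intro x
  have h1 : Filter.Tendsto (fun k : ℕ => C * (k : ℝ) ^ (-θ)) Filter.atTop (nhds (C * 0)) :=
    ((tendsto_rpow_neg_atTop hθ0).comp tendsto_natCast_atTop_atTop).const_mul C
  rw [mul_zero] at h1
  have h2 : (perc J hJ β).real {ω | ¬ (cluster ω x).Finite} ≤ 0 := by
    refine ge_of_tendsto h1 ((Filter.eventually_ge_atTop 1).mono fun k hk => ?_)
    refine (measureReal_mono fun ω hω => ?_).trans (perc_real_le_encard_cluster_le (x := x)
      (htail k hk))
    have h3 : (cluster ω x).encard = ⊤ := Set.encard_eq_top_iff.2 hω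
    simp [h3]
  exact (measureReal_eq_zero_iff (measure_ne_top _ _)).1 (le_antisymm h2 measureReal_nonneg)

theorem rpow_le_card_box {r : ℝ} (hr : 1 ≤ r) : r ^ (d : ℝ) ≤ (box d r).card := by
  rw [box, Pi.card_Icc]
  simp only [Int.card_Icc, Finset.prod_const, Finset.card_univ, Fintype.card_fin]
  rw [Real.rpow_natCast]
  push_cast
  refine pow_le_pow_left₀ (by linarith) ?_ d
  have h1 := Int.lt_floor_add_one r
  have h2 : (1 : ℤ) ≤ ⌊r⌋ := Int.le_floor.2 (by exact_mod_cast hr)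
  have h3 : ((⌊r⌋ + 1 - -⌊r⌋).toNat : ℝ) = 2 * (⌊r⌋ : ℝ) + 1 := by
    have h4 : ((⌊r⌋ + 1 - -⌊r⌋).toNat : ℤ) = 2 * ⌊r⌋ + 1 := by omega
    exact_mod_cast h4
  have h5 : (1 : ℝ) ≤ ⌊r⌋ := by exact_mod_cast h2
  rw [h3]
  linarith

end Critical

end LongRangePercolation

open LongRangePercolation

theorem theorem1p1 (d : ℕ) (hd : 1 ≤ d)
    (J : (Fin d → ℤ) → ℝ≥0) (hsymm : ∀ x, J (-x) = J x) (hint : Summable J)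
    (α c r₀ : ℝ) (hα : α < d) (hc : 0 < c)
    (hlow : ∀ x : Fin d → ℤ, r₀ ≤ LongRangePercolation.l1norm x →
      c * LongRangePercolation.l1norm x ^ (-(d : ℝ) - α) ≤ (J x : ℝ)) :
    (∃ C : ℝ, ∀ β : ℝ≥0, (β : ℝ≥0∞) ≤ LongRangePercolation.betaC J hsymm →
      (∀ n : ℕ, 1 ≤ n →
        (LongRangePercolation.perc J hsymm β).real
            {ω | (n : ℕ∞) ≤ (LongRangePercolation.cluster ω 0).encard}
          ≤ C * (n : ℝ) ^ (-((d : ℝ) - α) / (2 * (d : ℝ) + α))) ∧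
      (∀ r : ℝ, 1 ≤ r →
        (1 / ((LongRangePercolation.box d r).card : ℝ)) *
            ∑ x ∈ LongRangePercolation.box d r,
              (LongRangePercolation.perc J hsymm β).real
                {ω | x ∈ LongRangePercolation.cluster ω 0}
          ≤ C * r ^ (-2 * ((d : ℝ) - α) / 3))) ∧
    (∃ βc : ℝ≥0, LongRangePercolation.betaC J hsymm = βc ∧
      ∀ᵐ ω ∂(LongRangePercolation.perc J hsymm βc),
        ∀ x, (LongRangePercolation.cluster ω x).Finite) := by
  have hα0 : 0 < α := alpha_pos hd hint hc hlow
  have hd0 : (0 : ℝ) < d := by exact_mod_cast hd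
  have hden : 0 < 2 * (d : ℝ) + α := by linarith
  set θ : ℝ := ((d : ℝ) - α) / (2 * d + α) with hθdef
  have hθ0 : 0 < θ := div_pos (by linarith) hden
  have hθ : θ < 1 := by rw [hθdef, div_lt_one hden]; linarith
  -- A bound uniform over subcritical parameters that are bounded away from zero.
  have hunif : ∀ β₀ : ℝ≥0, 0 < β₀ → ∃ C : ℝ, 1 ≤ C ∧ ∀ β : ℝ≥0, β₀ ≤ β →
      (β : ℝ≥0∞) < betaC J hsymm → ∀ k : ℕ, 1 ≤ k →
        tail (edgeProb J hsymm β) k ≤ C * (k : ℝ) ^ (-θ) := by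
    intro β₀ hβ₀
    obtain ⟨κ, hκ, hlow'⟩ := exists_edgeProb_lower_bound (hJ := hsymm) hd hα0 hc hlow hβ₀
    obtain ⟨C, hC1, hC⟩ := exists_uniform_tail_bound hd hα0 hα hκ ⌈r₀⌉₊ hθdef
    refine ⟨C, hC1, fun β hβ hβc => ?_⟩
    obtain ⟨β', hlt, hfin⟩ := exists_finite_of_lt_betaC hβc
    exact hC _ edgeProb_mem_Icc edgeProb_shift (hlow' β hβ)
      (exists_tail_bound_of_lt hint hlt hfin hθ.le)
  have hfinite : betaC J hsymm ≠ ⊤ := by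
    intro htop
    obtain ⟨C, hC1, hC⟩ := hunif 1 one_pos
    have h1 : Filter.Tendsto (fun k : ℕ => C * (k : ℝ) ^ (-θ)) Filter.atTop (nhds (C * 0)) :=
      ((tendsto_rpow_neg_atTop hθ0).comp tendsto_natCast_atTop_atTop).const_mul C
    rw [mul_zero] at h1
    obtain ⟨n, hn, hn1⟩ := ((h1.eventually (gt_mem_nhds one_pos)).and
      (Filter.eventually_ge_atTop 1)).exists
    obtain ⟨β, hβ, hlt⟩ := exists_tail_gt (hJ := hsymm) hd hc hlow n hn
    exact absurd (hC β hβ (htop ▸ ENNReal.coe_lt_top) n hn1) (not_le.2 hlt)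
  obtain ⟨b, hb⟩ : ∃ b : ℝ≥0, (b : ℝ≥0∞) = betaC J hsymm := ⟨_, ENNReal.coe_toNNReal hfinite⟩
  obtain ⟨C, hC1, hC⟩ : ∃ C : ℝ, 1 ≤ C ∧ ∀ β : ℝ≥0, β ≤ b → ∀ k : ℕ, 1 ≤ k →
      tail (edgeProb J hsymm β) k ≤ C * (k : ℝ) ^ (-θ) := by
    rcases eq_or_ne b 0 with rfl | hb0
    · refine ⟨1, le_rfl, fun β hβ k hk => ?_⟩
      obtain rfl : β = 0 := le_antisymm hβ zero_le
      exact tail_edgeProb_zero_le hk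
    · have hb0' : 0 < b := pos_iff_ne_zero.2 hb0
      obtain ⟨C, hC1, hC⟩ := hunif (b / 2) (half_pos hb0')
      have hlt : ∀ β : ℝ≥0, β < b → ∀ k : ℕ, 1 ≤ k →
          tail (edgeProb J hsymm β) k ≤ C * (k : ℝ) ^ (-θ) := fun β hβ k hk =>
        (tail_mono (le_max_left β (b / 2)) k).trans (hC _ (le_max_right _ _) (by
          rw [← hb, ENNReal.coe_lt_coe]
          exact max_lt hβ (half_lt_self hb0')) k hk)
      refine ⟨C, hC1, fun β hβ k hk => ?_⟩
      rcases hβ.eq_or_lt with rfl | hβ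
      · exact tail_le_of_forall_lt hb0' fun β hβ => hlt β hβ k hk
      · exact hlt β hβ k hk
  refine ⟨⟨C + 96 / (1 - θ) * C ^ (2 / (1 + θ)), fun β hβ => ?_⟩, b, hb.symm,
    ae_finite_of_tail hθ0 (hC b le_rfl)⟩
  have hβb : β ≤ b := by rwa [← hb, ENNReal.coe_le_coe] at hβ
  have h1θ : 0 < 1 - θ := by linarith
  have hC' : 0 ≤ 96 / (1 - θ) * C ^ (2 / (1 + θ)) := by positivity
  constructor
  · intro n hn
    refine (perc_real_le_encard_cluster_le (hC β hβb n hn)).trans ?_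
    rw [neg_div, ← hθdef]
    exact mul_le_mul_of_nonneg_right (by linarith) (by positivity)
  · intro r hr
    have hr0 : 0 < r := by linarith
    have hbox := rpow_le_card_box (d := d) hr
    have hrd : 0 < r ^ (d : ℝ) := Real.rpow_pos_of_pos hr0 _
    have hB0 : (0 : ℝ) < (box d r).card := hrd.trans_le hbox
    have hsum := sum_two_point_le hθ0 hθ hC1 (hC β hβb) (B := box d r) (by exact_mod_cast hB0)
    have h1 : ((box d r).card : ℝ) ^ ((1 - θ) / (1 + θ)) =
        (box d r).card * ((box d r).card : ℝ) ^ (-(2 * θ / (1 + θ))) := by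
      rw [show (1 - θ) / (1 + θ) = 1 + -(2 * θ / (1 + θ)) by field_simp; ring,
        Real.rpow_add hB0, Real.rpow_one]
    have h2 : ((box d r).card : ℝ) ^ (-(2 * θ / (1 + θ))) ≤ r ^ (-2 * ((d : ℝ) - α) / 3) := by
      refine (Real.rpow_le_rpow_of_nonpos hrd hbox ?_).trans (le_of_eq ?_)
      · rw [neg_nonpos]; positivity
      · rw [← Real.rpow_mul hr0.le]
        congr 1
        have h3 : 1 + θ = 3 * d / (2 * d + α) := by rw [hθdef]; field_simp; ring
        rw [h3, hθdef]
        field_simp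
    rw [h1] at hsum
    rw [one_div, inv_mul_le_iff₀ hB0]
    refine hsum.trans ?_
    have h4 := mul_le_mul_of_nonneg_left h2 (mul_nonneg hC' hB0.le)
    have h5 : 0 ≤ C * ((box d r).card * r ^ (-2 * ((d : ℝ) - α) / 3)) := by positivity
    linarith
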